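/- Let $\mathbb K$ be a perfect field and let $F\in\mathbb K[[x]][y]$ be a square-free Weierstrass polynomial (monic in $y$, all other coefficients vanishing at $x=0$) of degree $d\ge 1$, where $\mathbb K$ has characteristic $0$ or greater than $d$. *Edge data.* Let $\mathbb L$ be a field and $H=\sum a_i(x)y^i=\sum a_{ij}x^jy^i\in\mathbb L[[x]][y]$ a Weierstrass polynomial. Its Newton polygon $\mathcal N(H)$ is the lower convex hull of the points $(i,\operatorname{val}_x a_i)$, $a_i\ne0$, and its boundary polynomial is $\bar H=\sum_{(i,j)\in\mathcal N(H)}a_{ij}x^jy^i$. One says that $H$ is degenerated over $\mathbb L$, with edge data $(q,m,P,N)$, if $\mathcal N(H)$ is straight of slope $-m/q$ with $q>0$, $m\ge0$ coprime (with $(q,m)=(1,0)$ if $\mathcal N(H)$ is a point) and $\bar H=c\,\bigl(P(y^q/x^m)\,x^{m\deg P}\bigr)^N$ with $c\in\mathbb L^\times$, $N\in\mathbb N$ and $P\in\mathbb L[Z]$ monic irreducible. *The algorithm.* Put $N_0=d$, $\mathbb K_0=\mathbb K$, $c_0=-\operatorname{coeff}(F,y^{d-1})/d$ and $H_0=F(x,y+c_0(x))$.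 Given $H_{k-1}\in\mathbb K_{k-1}[[x]][y]$ of degree $N_{k-1}>1$ and degenerated over $\mathbb K_{k-1}$, let $(q_k,m_k,P_k,N_k)$ be its edge data, $\ell_k=\deg P_k$, $\mathbb K_k=\mathbb K_{k-1}[Z]/(P_k)$, $z_k$ the residue class of $Z$, and $s_k>0$, $0\le t_k<q_k$ the integers with $q_ks_k-t_km_k=1$. There are a unique unit $V_k\in\mathbb K_k[[x,y]]$ and a unique Weierstrass polynomial $G_k\in\mathbb K_k[[x]][y]$ of degree $N_k$ with $$H_{k-1}\bigl(z_k^{t_k}x^{q_k},\,x^{m_k}(y+z_k^{s_k})\bigr)=x^{q_km_k\ell_kN_k}\,G_k\,V_k;$$ put $c_k=-\operatorname{coeff}(G_k,y^{N_k-1})/N_k$ and $H_k=G_k(x,y+c_k(x))$. Let $g$ be the smallest index such that $N_g=1$, or $N_g>1$ and $H_g$ is not degenerated over $\mathbb K_g$. *Valuations and minimal polynomials.* Put $\pi_0(x,y)=(x,y+c_0(x))$ and $\pi_k=\pi_{k-1}\circ\sigma_k$ with $\sigma_k(x,y)=\bigl(z_k^{t_k}x^{q_k},\,x^{m_k}(y+z_k^{s_k}+c_k(x))\bigr)$.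 For $A\in\mathbb K[[x]][y]$ let $v_k(A)\in\mathbb N\cup\{\infty\}$ be the $x$-adic valuation of $\pi_k^*A\in\mathbb K_k[[x]][y]$ (the minimum of the valuations of its coefficients), and for $A\neq 0$ let $\lambda_k(A)\in\mathbb K_k^\times$ be the trailing coefficient with respect to $y$ of $\bigl(\pi_k^*A/x^{v_k(A)}\bigr)_{|x=0}$. Let $\phi_{-1}=x$ and, for $0\le k\le g$, let $\phi_k\in\mathbb K[[x]][y]$ be the unique monic irreducible polynomial with $\phi_k(\pi_k(x,0))=0$. Write $v_{k,i}=v_k(\phi_i)$ and $\lambda_{k,i}=\lambda_k(\phi_i)$. **Proposition.** For all $1\le k\le g$, $$v_{k,k}=q_k\,\ell_k\,v_{k,k-1},\qquad \lambda_{k,k}=q_k\,z_k^{1-s_k-\ell_k}\,P_k'(z_k)\,\lambda_{k,k-1}^{\,q_k\ell_k}.$$ Together with the initial values $v_{0,-1}=1$, $v_{0,0}=0$, $\lambda_{0,-1}=\lambda_{0,0}=1$ and the relations, for $1\le k\le g$, $$v_{k,i}=q_kv_{k-1,i},\quad \lambda_{k,i}=\lambda_{k-1,i}\,z_k^{t_kv_{k-1,i}}\quad(-1\le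 i<k-1),$$ $$v_{k,k-1}=q_kv_{k-1,k-1}+m_k,\quad \lambda_{k,k-1}=\lambda_{k-1,k-1}\,z_k^{t_kv_{k-1,k-1}+s_k},$$ which hold as well, this determines recursively the lists $V=(v_{k,-1},\dots,v_{k,k})$ and $\Lambda=(\lambda_{k,-1},\dots,\lambda_{k,k})$ for $0\le k\le g$. -/

import Mathlib

noncomputable section

open Polynomial PowerSeries

namespace RationalPuiseux

/-! In `L⟦X⟧[X]` the power series variable plays the role of `x` and the polynomial variable
plays the role of `y`. -/

section Newton

variable {L : Type*} [Field L]

/-- Weierstrass polynomials of `L[[x]][y]`: monic in `y`, all lower coefficients vanish at `x = 0`. -/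
def IsWeierstrass (F : L⟦X⟧[X]) : Prop :=
  F.Monic ∧ ∀ i < F.natDegree, PowerSeries.constantCoeff (F.coeff i) = 0

/-- The points `(i, ord_x a_i)`, `a_i ≠ 0`, of `F = ∑ a_i y ^ i`. -/
def newtonPoints (F : L⟦X⟧[X]) : Set (ℝ × ℝ) :=
  {p | ∃ i j : ℕ, (F.coeff i).order = (j : ℕ∞) ∧ p = ((i : ℝ), (j : ℝ))}

/-- The Newton polygon: the lower boundary of the convex hull of the points `(i, ord_x a_i)`. -/
def newtonPolygon (F : L⟦X⟧[X]) : Set (ℝ × ℝ) :=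
  {p | p ∈ convexHull ℝ (newtonPoints F) ∧
    ∀ p' ∈ convexHull ℝ (newtonPoints F), p'.1 = p.1 → p.2 ≤ p'.2}

open Classical in
/-- The boundary polynomial: the sum of the terms `a_ij x ^ j y ^ i` of `F` whose exponent `(i, j)`
lies on the Newton polygon. -/
def boundaryPolynomial (F : L⟦X⟧[X]) : L⟦X⟧[X] :=
  ∑ i ∈ Finset.range (F.natDegree + 1),
    Polynomial.monomial i (PowerSeries.mk fun j =>
      if ((i : ℝ), (j : ℝ)) ∈ newtonPolygon F then PowerSeries.coeff j (F.coeff i) else 0)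

/-- The quasi-homogeneous polynomial `P(y ^ q / x ^ m) * x ^ (m * deg P)`. -/
def quasiHomogenization (q m : ℕ) (P : L[X]) : L⟦X⟧[X] :=
  P.sum fun i a =>
    Polynomial.monomial (q * i) (PowerSeries.monomial (m * (P.natDegree - i)) a)

/-- The `x`-adic valuation on `L[[x]][y]`: the minimum of the orders of the coefficients. -/
def xVal (A : L⟦X⟧[X]) : ℕ∞ := ⨅ i : ℕ, (A.coeff i).order

/-- The trailing coefficient (with respect to `y`) of `(A / x ^ v)` at `x = 0`, where `v` is the
`x`-adic valuation of `A`; it is `0` for `A = 0`. -/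
def xInitial (A : L⟦X⟧[X]) : L :=
  (∑ i ∈ Finset.range (A.natDegree + 1),
    Polynomial.monomial i (PowerSeries.coeff (xVal A).toNat (A.coeff i))).trailingCoeff

/-- The substitution `H(x, y) ↦ H(a x ^ q, Y)` on `L[[x]][y]`, for `q ≠ 0`. -/
def substHom (a : L) (q : ℕ) (hq : q ≠ 0) (Y : L⟦X⟧[X]) : L⟦X⟧[X] →+* L⟦X⟧[X] :=
  Polynomial.eval₂RingHom
    ((Polynomial.C : L⟦X⟧ →+* L⟦X⟧[X]).comp
      (((PowerSeries.expand (R := L) q hq : L⟦X⟧ →ₐ[L] L⟦X⟧) : L⟦X⟧ →+* L⟦X⟧).comp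
        (PowerSeries.rescale a))) Y

end Newton

section Degenerate

variable {K E : Type*} [Field K] [Field E] [Algebra K E]

/-- `(q, m, P, N)` is the edge data of the polynomial `F`, degenerated over the subfield `k` of `E`
(`F` has coefficients in `k`): the Newton polygon is straight of slope `-m/q` with `q, m` coprime
(and `(q, m) = (1, 0)` by convention if it is a single point), and the boundary polynomial is
`c * (P(y ^ q / x ^ m) * x ^ (m * deg P)) ^ N` with `P` monic, with coefficients in `k` and
irreducible over `k`. -/
structure IsEdgeData (k : IntermediateField K E) (F : E⟦X⟧[X]) (q m : ℕ) (P : E[X]) (N : ℕ) :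
    Prop where
  q_pos : 0 < q
  coprime : Nat.Coprime q m
  straight : ∀ p ∈ newtonPolygon F, ∀ p' ∈ newtonPolygon F,
    (q : ℝ) * (p.2 - p'.2) = -((m : ℝ) * (p.1 - p'.1))
  point : (newtonPolygon F).Subsingleton → q = 1 ∧ m = 0
  monic : P.Monic
  irreducible : ∃ p : (k)[X], Irreducible p ∧ p.map (algebraMap k E) = P
  boundary : ∃ c : E, c ≠ 0 ∧ boundaryPolynomial F =
    Polynomial.C (PowerSeries.C c) * quasiHomogenization q m P ^ N

/-- `F` (with coefficients in the subfield `k`) is degenerated over `k`. -/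
def IsDegenerate (k : IntermediateField K E) (F : E⟦X⟧[X]) : Prop :=
  ∃ (q m : ℕ) (P : E[X]) (N : ℕ), IsEdgeData k F q m P N

end Degenerate

/-- The quantities that the Newton-Puiseux type algorithm computes. All residue fields live in a
common field `E`. Only the values with index at most `g` (and at least `1` for
`q, m, s, t, P, z, G`) are meaningful. -/
structure Data (E : Type*) [Field E] where
  /-- number of steps -/
  g : ℕ
  (q m N s t : ℕ → ℕ)
  /-- normalisation off the meaningful range, so that all substitutions are defined -/
  q_ne_zero : ∀ k, q k ≠ 0
  /-- residual polynomials -/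
  P : ℕ → E[X]
  /-- residue classes -/
  z : ℕ → E
  c : ℕ → E⟦X⟧
  (G H : ℕ → E⟦X⟧[X])

namespace Data

section

variable {E : Type*} [Field E] (D : Data E)

/-- `ℓ_k = deg P_k`. -/
def ell (k : ℕ) : ℕ := (D.P k).natDegree

/-- The residue field `𝕂_k = K(z_1, …, z_k)`. As `z_k` will be a root of `P_k`, irreducible over
`𝕂_{k-1}`, this is `𝕂_{k-1}[Z]/(P_k)` with `z_k` the residue class of `Z`. -/
def residueField (K : Type*) [Field K] [Algebra K E] (k : ℕ) : IntermediateField K E :=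
  IntermediateField.adjoin K {w | ∃ i, 1 ≤ i ∧ i ≤ k ∧ w = D.z i}

/-- The pull-back by `(x, y) ↦ (z_k ^ t_k x ^ q_k, x ^ m_k (y + z_k ^ s_k + b(x)))`. -/
def shiftedSigma (k : ℕ) (b : E⟦X⟧) : E⟦X⟧[X] →+* E⟦X⟧[X] :=
  substHom (D.z k ^ D.t k) (D.q k) (D.q_ne_zero k)
    (Polynomial.C ((PowerSeries.X : E⟦X⟧) ^ D.m k) *
      (Polynomial.X + Polynomial.C (PowerSeries.C (D.z k ^ D.s k)) + Polynomial.C b))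

/-- The pull-back `σ_k^*` by
`σ_k(x, y) = (z_k ^ t_k x ^ q_k, x ^ m_k (y + z_k ^ s_k + c_k(x)))`. -/
def sigma (k : ℕ) : E⟦X⟧[X] →+* E⟦X⟧[X] := D.shiftedSigma k (D.c k)

/-- The pull-back `π_k^*` : `π_0(x, y) = (x, y + c_0(x))` and `π_k = π_{k-1} ∘ σ_k`. -/
def piPull (K : Type*) [Field K] [Algebra K E] : ℕ → (K⟦X⟧[X] →+* E⟦X⟧[X])
  | 0 => (Polynomial.compRingHom (Polynomial.X + Polynomial.C (D.c 0))).comp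
      (Polynomial.mapRingHom (PowerSeries.map (algebraMap K E)))
  | k + 1 => (D.sigma (k + 1)).comp (piPull K k)

/-- The ring homomorphism `A(x, y) ↦ A(π_k(x, 0))` from `K[[x]][y]` to `E[[x]]`: evaluation at the
truncated rational Puiseux parametrisation `π_k(x, 0) = (μ_k x ^ e_k, S_k(x))`. -/
def evalParam (K : Type*) [Field K] [Algebra K E] (k : ℕ) : K⟦X⟧[X] →+* E⟦X⟧ :=
  (Polynomial.evalRingHom 0).comp (D.piPull K k)

/-- The `k`-th minimal polynomial `φ_k`: the minimal polynomial of `S_k(x)` over `K[[x]]`, where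
`K[[x]]` acts on power series through `x ↦ μ_k x ^ e_k`. As `K[[x]]` is integrally closed, this is
the unique monic irreducible `φ` in `K[[x]][y]` with `φ(μ_k x ^ e_k, S_k(x)) = 0`. -/
def minimalPolynomial (K : Type*) [Field K] [Algebra K E] (k : ℕ) : K⟦X⟧[X] :=
  letI : Algebra K⟦X⟧ E⟦X⟧ := ((D.evalParam K k).comp Polynomial.C).toAlgebra
  minpoly K⟦X⟧ (D.evalParam K k Polynomial.X)

/-- The sequence `φ_{-1} = x`, `φ_0`, `φ_1`, … -/
def phi (K : Type*) [Field K] [Algebra K E] (i : ℤ) : K⟦X⟧[X] :=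
  if i < 0 then Polynomial.C PowerSeries.X else D.minimalPolynomial K i.toNat

/-- The valuation `v_k(A) = val(π_k^* A)`. -/
def v {K : Type*} [Field K] [Algebra K E] (k : ℕ) (A : K⟦X⟧[X]) : ℕ∞ :=
  xVal (D.piPull K k A)

/-- `λ_k(A)`: the trailing coefficient in `y` of `(π_k^* A / x ^ v_k(A))` at `x = 0`. -/
def lam {K : Type*} [Field K] [Algebra K E] (k : ℕ) (A : K⟦X⟧[X]) : E :=
  xInitial (D.piPull K k A)

/-- `v_{k,i} = v_k(φ_i)`. -/
def vv (K : Type*) [Field K] [Algebra K E] (k : ℕ) (i : ℤ) : ℕ∞ := D.v k (D.phi K i)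

/-- `λ_{k,i} = λ_k(φ_i)`. -/
def ll (K : Type*) [Field K] [Algebra K E] (k : ℕ) (i : ℤ) : E := D.lam k (D.phi K i)

end

/-- `D` records a run of the Newton-Puiseux type algorithm on the Weierstrass polynomial `F`. -/
structure IsRun {K E : Type*} [Field K] [Field E] [Algebra K E] (D : Data E) (F : K⟦X⟧[X]) :
    Prop where
  /- Rank `0`. -/
  N_zero : D.N 0 = F.natDegree
  c_zero : D.c 0 =
    -(((D.N 0 : E)⁻¹) • PowerSeries.map (algebraMap K E) (F.coeff (D.N 0 - 1)))
  H_zero : D.H 0 = (F.map (PowerSeries.map (algebraMap K E))).comp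
    (Polynomial.X + Polynomial.C (D.c 0))
  /- Rank `k + 1`, for `k < g`: the algorithm has not stopped at `H_k`. -/
  one_lt : ∀ k < D.g, 1 < D.N k
  edge : ∀ k < D.g, IsEdgeData (D.residueField K k) (D.H k)
    (D.q (k + 1)) (D.m (k + 1)) (D.P (k + 1)) (D.N (k + 1))
  root : ∀ k < D.g, (D.P (k + 1)).eval (D.z (k + 1)) = 0
  bezout : ∀ k < D.g, D.q (k + 1) * D.s (k + 1) = D.t (k + 1) * D.m (k + 1) + 1
  s_pos : ∀ k < D.g, 0 < D.s (k + 1)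
  t_lt : ∀ k < D.g, D.t (k + 1) < D.q (k + 1)
  G_coeff : ∀ k < D.g, ∀ i j : ℕ,
    PowerSeries.coeff j ((D.G (k + 1)).coeff i) ∈ D.residueField K (k + 1)
  G_weierstrass : ∀ k < D.g, IsWeierstrass (D.G (k + 1))
  G_natDegree : ∀ k < D.g, (D.G (k + 1)).natDegree = D.N (k + 1)
  /- `H_k(z ^ t x ^ q, x ^ m (y + z ^ s)) = x ^ (q m ℓ N) G V` with `V` a unit of
  `E[[x, y]] = E[[x]][[y]]`, all indices of `z, t, q, m, s, ℓ, N, G, V` being `k + 1`. -/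
  G_eq : ∀ k < D.g, ∃ V : (E⟦X⟧)⟦X⟧, IsUnit V ∧
    ((D.shiftedSigma (k + 1) 0 (D.H k) : E⟦X⟧[X]) : (E⟦X⟧)⟦X⟧) =
      PowerSeries.C ((PowerSeries.X : E⟦X⟧) ^
        (D.q (k + 1) * D.m (k + 1) * D.ell (k + 1) * D.N (k + 1))) *
      ((D.G (k + 1) : E⟦X⟧[X]) : (E⟦X⟧)⟦X⟧) * V
  c_succ : ∀ k < D.g, D.c (k + 1) =
    -(((D.N (k + 1) : E)⁻¹) • (D.G (k + 1)).coeff (D.N (k + 1) - 1))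
  H_succ : ∀ k < D.g, D.H (k + 1) =
    (D.G (k + 1)).comp (Polynomial.X + Polynomial.C (D.c (k + 1)))
  /- The algorithm stops at rank `g`. -/
  terminal : D.N D.g = 1 ∨ (1 < D.N D.g ∧ ¬ IsDegenerate (D.residueField K D.g) (D.H D.g))

end Data

end RationalPuiseux

end

/-! Write `d_k` for the degree of `φ_k`, equal to `q_k ℓ_k ⋯ q_1 ℓ_1`. Two facts are carried along
by induction on the rank: a nonzero polynomial of degree less than `d_k` pulls back under `π_k` to a
power of `x` times a unit at the origin (`IsUnitBelow`), and `π_k^* φ_k = y U` with `U` of the same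
shape, `x ^ α` times a unit with constant term `β`. Thus `v_{k,k} = α` and `λ_{k,k} = β`.

For the step, expand a polynomial in powers of `φ_k` and pull back each term. As `q` and `m` are
coprime, the terms of least weight sit at indices `i₀ + q j`, and together they form a power of `z`
times `(y + z^s)^{i₀} Q((y + z^s)^q / z^{tm})` with `Q` over `𝕂_k`. At `y = 0` the argument of `Q`
is `z`, because `q s - t m = 1`. Below degree `q ℓ d_k` one has `deg Q < ℓ`, so `Q(z) ≠ 0`, which is
the first fact at the next rank. For `φ_{k+1}`, which vanishes on the parametrisation, `Q(z) = 0`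
forces `i₀ = 0` and `Q = β^{qℓ} P`; differentiating at `y = 0` gives both formulas. This is
`IsStep.isUnitBelow` and `IsStep.pullback_monic`.

The degree of `φ_k` is bounded below by the first fact and above by a characteristic polynomial,
since `𝕂_k[[x]]` has rank `[𝕂_k : K] e_k` over `K[[x]]` (`exists_monic_eval₂_eq_zero`).

All this needs `m_k > 0` and `z_k ≠ 0`, that is, `H_{k-1}` is not a pure power of `y`.
Squarefreeness of `F` ensures it, through the absence of double roots in the maximal ideal, a
property inherited by every `H_k` (`NoDoubleRoot`). The characteristic makes `q_k` and `P_k'(z_k)`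
nonzero. -/

noncomputable section

open Polynomial PowerSeries

namespace RationalPuiseux

/-! ### Double roots, and their comparison between polynomials and power series. -/

section DoubleRoots

/-- Divisibility by a distinguished polynomial can be tested after passing to power series. -/
theorem dvd_of_coe_dvd_coe {R : Type*} [CommRing R] {I : Ideal R} [IsHausdorff I R] (hI : I ≠ ⊤)
    {g A : R[X]} (hg : g.IsDistinguishedAt I) (h : (g : R⟦X⟧) ∣ (A : R⟦X⟧)) : g ∣ A := by
  obtain ⟨T, hT⟩ := h
  have hdeg : (A %ₘ g).degree < (((g : R⟦X⟧).map (Ideal.Quotient.mk I)).order.toNat : ℕ) := by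
    have h1 : (g.natDegree : ℕ∞) = ((g : R⟦X⟧).map (Ideal.Quotient.mk I)).order :=
      hg.coe_natDegree_eq_order_map (g : R⟦X⟧) 1
        (by rwa [PowerSeries.constantCoeff_one, ← Ideal.ne_top_iff_one]) (by simp)
    have : Nontrivial R := nontrivial_of_ne (0 : R) 1 fun h => hI <| by
      rw [Ideal.eq_top_iff_one, ← h]; exact I.zero_mem
    rw [← h1, ENat.toNat_natCast, ← degree_eq_natDegree hg.monic.ne_zero]
    exact degree_modByMonic_lt A hg.monic
  -- Both `A = g T` and Euclidean division of `A` are Weierstrass divisions by `g`; by uniqueness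
  -- the remainder is zero.
  have heq : (g : R⟦X⟧) * (T - ((A /ₘ g : R[X]) : R⟦X⟧)) = ((A %ₘ g : R[X]) : R⟦X⟧) := by
    have := modByMonic_add_div A g
    rw [mul_sub, ← hT, ← Polynomial.coe_mul, ← Polynomial.coe_sub, sub_eq_iff_eq_add.mpr this.symm]
  have := ((hg.isWeierstrassDivisorAt hI).eq_zero_of_mul_eq hdeg heq).2
  exact (modByMonic_eq_zero_iff_dvd hg.monic).mp this

theorem sq_dvd_iff_isRoot {R : Type*} [CommRing R] [IsDomain R] (A : R[X]) (ρ : R) :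
    (Polynomial.X - Polynomial.C ρ) ^ 2 ∣ A ↔ A.eval ρ = 0 ∧ (derivative A).eval ρ = 0 := by
  rcases eq_or_ne A 0 with rfl | hA
  · simp
  · rw [← le_rootMultiplicity_iff hA]
    exact one_lt_rootMultiplicity_iff_isRoot hA

/-- A double root in the maximal ideal is preserved by multiplication by a power series. -/
theorem double_root_of_coe_eq_mul {R : Type*} [CommRing R] [IsDomain R] {I : Ideal R}
    [IsHausdorff I R] (hI : I ≠ ⊤) {A G : R[X]} {W : R⟦X⟧} (h : (A : R⟦X⟧) = (G : R⟦X⟧) * W)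
    {ρ : R} (hρ : ρ ∈ I) (h0 : G.eval ρ = 0) (h1 : (derivative G).eval ρ = 0) :
    A.eval ρ = 0 ∧ (derivative A).eval ρ = 0 := by
  rw [← sq_dvd_iff_isRoot] at *
  have hlin : (Polynomial.X - Polynomial.C ρ).IsDistinguishedAt I := by
    refine ⟨⟨fun {n} hn => ?_⟩, monic_X_sub_C ρ⟩
    rw [natDegree_X_sub_C] at hn
    obtain rfl : n = 0 := by omega
    simpa using hρ
  -- Since `ρ ∈ I`, the square of `y - ρ` is distinguished, so its divisibility can be brought back
  -- from `R[[y]]` to `R[y]`.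
  have hsq : ((Polynomial.X - Polynomial.C ρ) ^ 2).IsDistinguishedAt I := by
    rw [pow_two]; exact hlin.mul hlin
  refine dvd_of_coe_dvd_coe hI hsq ?_
  obtain ⟨B, hB⟩ : (Polynomial.X - Polynomial.C ρ) ^ 2 ∣ G := by
    rw [sq_dvd_iff_isRoot]; exact ⟨h0, h1⟩
  exact ⟨(B : R⟦X⟧) * W, by rw [h, hB, Polynomial.coe_mul, mul_assoc]⟩

/-- A squarefree monic polynomial of small degree has no double root in an extension domain. -/
theorem not_double_root_of_squarefree {R S : Type*} [CommRing R] [IsDomain R]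
    [IsIntegrallyClosed R] [CommRing S] [IsDomain S] (ψ : R →+* S)
    (hψ : Function.Injective ψ) {F : R[X]} (hF : F.Monic) (hsq : Squarefree F)
    (hchar : ∀ n : ℕ, 0 < n → n ≤ F.natDegree → (n : R) ≠ 0) (ρ : S)
    (h0 : F.eval₂ ψ ρ = 0) : (derivative F).eval₂ ψ ρ ≠ 0 := by
  let _ : Algebra R S := ψ.toAlgebra
  have : FaithfulSMul R S := (faithfulSMul_iff_algebraMap_injective R S).mpr hψ
  intro h1
  have hint : IsIntegral R ρ := ⟨F, hF, h0⟩
  have hdvd : ∀ p : R[X], p.eval₂ ψ ρ = 0 → minpoly R ρ ∣ p :=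
    fun p hp => minpoly.isIntegrallyClosed_dvd hint hp
  have hmin : (minpoly R ρ).eval₂ ψ ρ = 0 := minpoly.aeval R ρ
  have hmon := minpoly.monic hint
  have hpos := minpoly.natDegree_pos hint
  obtain ⟨g, hg⟩ := hdvd F h0
  have hle : (minpoly R ρ).natDegree ≤ F.natDegree :=
    natDegree_le_of_dvd ⟨g, hg⟩ hF.ne_zero
  rw [hg, derivative_mul, eval₂_add, eval₂_mul, eval₂_mul, hmin, zero_mul, add_zero,
    mul_eq_zero] at h1
  -- With `F = μ g` and `μ` minimal, `F'(ρ) = μ'(ρ) g(ρ)`. If the first factor vanishes, minimality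
  -- gives `μ' = 0`, against the nonzero coefficient `deg μ`. If the second vanishes, `μ²` divides
  -- `F`.
  rcases h1 with h1 | h1
  · have hlt : (derivative (minpoly R ρ)).natDegree < (minpoly R ρ).natDegree :=
      natDegree_derivative_lt hpos.ne'
    have hz := eq_zero_of_dvd_of_natDegree_lt (hdvd _ h1) hlt
    have hc := congr_arg (fun p => p.coeff ((minpoly R ρ).natDegree - 1)) hz
    simp only [Polynomial.coeff_derivative, Polynomial.coeff_zero] at hc
    rw [Nat.sub_add_cancel hpos, hmon.coeff_natDegree, one_mul, ← Nat.cast_succ,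
      Nat.succ_eq_add_one, Nat.sub_add_cancel hpos] at hc
    exact hchar _ hpos hle hc
  · obtain ⟨g', hg'⟩ := hdvd g h1
    have hu := hsq (minpoly R ρ) ⟨g', by rw [mul_assoc, ← hg', ← hg]⟩
    rw [hmon.isUnit_iff] at hu
    rw [hu] at hpos
    simp at hpos

end DoubleRoots

/-! ### Monomial substitutions and the transport of `NoDoubleRoot`. -/

section Substitution

variable {L : Type*} [Field L]

/-- The substitution `f(x) ↦ f(a x ^ q)` on power series. -/
def seriesSubst (a : L) (q : ℕ) (hq : q ≠ 0) : L⟦X⟧ →+* L⟦X⟧ :=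
  (((PowerSeries.expand (R := L) q hq : L⟦X⟧ →ₐ[L] L⟦X⟧) : L⟦X⟧ →+* L⟦X⟧).comp
        (PowerSeries.rescale a))

theorem seriesSubst_X (a : L) (q : ℕ) (hq : q ≠ 0) :
    seriesSubst a q hq PowerSeries.X = PowerSeries.C a * PowerSeries.X ^ q := by
  simp [seriesSubst, PowerSeries.rescale_X, PowerSeries.expand_C]

theorem coeff_mul_seriesSubst (a : L) (q : ℕ) (hq : q ≠ 0) (f : L⟦X⟧) (n : ℕ) :
    PowerSeries.coeff (q * n) (seriesSubst a q hq f) = a ^ n * PowerSeries.coeff n f := by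
  simp [seriesSubst, PowerSeries.coeff_expand_mul, PowerSeries.coeff_rescale]

theorem constantCoeff_seriesSubst (a : L) (q : ℕ) (hq : q ≠ 0) (f : L⟦X⟧) :
    PowerSeries.constantCoeff (seriesSubst a q hq f) = PowerSeries.constantCoeff f := by
  rw [← PowerSeries.coeff_zero_eq_constantCoeff_apply, ← PowerSeries.coeff_zero_eq_constantCoeff_apply]
  have := coeff_mul_seriesSubst a q hq f 0
  simpa using this

theorem coeff_seriesSubst_of_not_dvd (a : L) (q : ℕ) (hq : q ≠ 0) (f : L⟦X⟧) {n : ℕ}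
    (hn : ¬ q ∣ n) : PowerSeries.coeff n (seriesSubst a q hq f) = 0 := by
  simp [seriesSubst, PowerSeries.coeff_expand_of_not_dvd _ _ _ hn]

theorem seriesSubst_injective {a : L} (ha : a ≠ 0) (q : ℕ) (hq : q ≠ 0) :
    Function.Injective (seriesSubst a q hq) := by
  rw [injective_iff_map_eq_zero]
  intro f hf
  ext n
  have := coeff_mul_seriesSubst a q hq f n
  rw [hf, map_zero, eq_comm, mul_eq_zero] at this
  simpa using this.resolve_left (pow_ne_zero _ ha)

theorem substHom_apply (a : L) (q : ℕ) (hq : q ≠ 0) (Y B : L⟦X⟧[X]) :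
    substHom a q hq Y B = B.eval₂ (Polynomial.C.comp (seriesSubst a q hq)) Y := rfl

theorem substHom_C (a : L) (q : ℕ) (hq : q ≠ 0) (Y : L⟦X⟧[X]) (f : L⟦X⟧) :
    substHom a q hq Y (Polynomial.C f) = Polynomial.C (seriesSubst a q hq f) := by
  simp [substHom_apply]

theorem substHom_X (a : L) (q : ℕ) (hq : q ≠ 0) (Y : L⟦X⟧[X]) :
    substHom a q hq Y Polynomial.X = Y := by
  simp [substHom_apply]

theorem derivative_substHom (a : L) (q : ℕ) (hq : q ≠ 0) (Y B : L⟦X⟧[X]) :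
    derivative (substHom a q hq Y B) = substHom a q hq Y (derivative B) * derivative Y := by
  induction B using Polynomial.induction_on' with
  | add p r hp hr => simp only [map_add, hp, hr, add_mul]
  | monomial n f =>
    rw [← Polynomial.C_mul_X_pow_eq_monomial, derivative_C_mul_X_pow]
    simp only [map_mul, map_pow, substHom_C, substHom_X, derivative_C_mul, Polynomial.derivative_pow,
      map_natCast]
    ring

theorem eval₂_substHom (τ : L⟦X⟧ →+* L⟦X⟧) (ρ : L⟦X⟧) (a : L) (q : ℕ) (hq : q ≠ 0)
    (Y B : L⟦X⟧[X]) :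
    (substHom a q hq Y B).eval₂ τ ρ = B.eval₂ (τ.comp (seriesSubst a q hq)) (Y.eval₂ τ ρ) := by
  rw [substHom_apply]
  have := Polynomial.hom_eval₂ B (Polynomial.C.comp (seriesSubst a q hq))
    (Polynomial.eval₂RingHom τ ρ) Y
  simp only [Polynomial.coe_eval₂RingHom] at this
  rw [this]
  congr 1
  ext f : 1
  simp

/-- `H` has no multiple root in the maximal ideal, even after a local base change. -/
def NoDoubleRoot (H : L⟦X⟧[X]) : Prop :=
  ∀ τ : L⟦X⟧ →+* L⟦X⟧, Function.Injective τ →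
    (∀ f, PowerSeries.constantCoeff f = 0 → PowerSeries.constantCoeff (τ f) = 0) →
    ∀ ρ, PowerSeries.constantCoeff ρ = 0 → H.eval₂ τ ρ = 0 → (derivative H).eval₂ τ ρ ≠ 0

theorem NoDoubleRoot.of_comp {G : L⟦X⟧[X]} {c : L⟦X⟧} (hc : PowerSeries.constantCoeff c = 0)
    (h : NoDoubleRoot G) : NoDoubleRoot (G.comp (Polynomial.X + Polynomial.C c)) := by
  intro τ hτ hloc ρ hρ h0 h1
  have hev : ∀ A : L⟦X⟧[X], (A.comp (Polynomial.X + Polynomial.C c)).eval₂ τ ρ =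
      A.eval₂ τ (ρ + τ c) := by
    intro A
    rw [eval₂_comp]
    simp
  have hder : derivative (G.comp (Polynomial.X + Polynomial.C c)) =
      (derivative G).comp (Polynomial.X + Polynomial.C c) := by
    rw [derivative_comp]; simp
  rw [hder, hev] at h1
  rw [hev] at h0
  exact h τ hτ hloc _ (by rw [map_add, hρ, hloc c hc, add_zero]) h0 h1

/-- A double root `ρ` of `G` is one of the substituted `H`. By the chain rule, whose extra factor is
`x ^ m`, the series `x ^ m (y + b)` evaluated at `ρ` is then a double root of `H`, in the maximal
ideal because `m > 0`, after composing the base change with `x ↦ a x ^ q`. This composition is why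
`NoDoubleRoot` quantifies over `τ`. -/
theorem NoDoubleRoot.of_substHom {H G : L⟦X⟧[X]} {W : (L⟦X⟧)⟦X⟧} {a b : L} {q m : ℕ} (hq : q ≠ 0)
    (ha : a ≠ 0) (hm : 0 < m)
    (hG : ((substHom a q hq (Polynomial.C ((PowerSeries.X : L⟦X⟧) ^ m) *
      (Polynomial.X + Polynomial.C (PowerSeries.C b) + Polynomial.C 0)) H : L⟦X⟧[X]) :
        (L⟦X⟧)⟦X⟧) = (G : (L⟦X⟧)⟦X⟧) * W)
    (h : NoDoubleRoot H) : NoDoubleRoot G := by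
  intro τ hτ hloc ρ hρ h0 h1
  set Y : L⟦X⟧[X] := Polynomial.C ((PowerSeries.X : L⟦X⟧) ^ m) *
      (Polynomial.X + Polynomial.C (PowerSeries.C b) + Polynomial.C 0) with hY
  have hG' := congr_arg (PowerSeries.map τ) hG
  rw [map_mul, ← Polynomial.polynomial_map_coe, ← Polynomial.polynomial_map_coe] at hG'
  have hroot := double_root_of_coe_eq_mul (I := IsLocalRing.maximalIdeal L⟦X⟧)
    (IsLocalRing.maximalIdeal.isMaximal _).ne_top hG' (ρ := ρ)
    (by
      rw [IsLocalRing.mem_maximalIdeal, mem_nonunits_iff, PowerSeries.isUnit_iff_constantCoeff, hρ]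
      exact not_isUnit_zero)
    (by rwa [eval_map]) (by rwa [derivative_map, eval_map])
  rw [eval_map, derivative_map, eval_map, derivative_substHom, eval₂_mul, eval₂_substHom,
    eval₂_substHom] at hroot
  have hτX : τ (PowerSeries.X ^ m) ≠ 0 := by
    rw [Ne, map_eq_zero_iff τ hτ]
    exact pow_ne_zero _ PowerSeries.X_ne_zero
  have hdY : (derivative Y).eval₂ τ ρ = τ (PowerSeries.X ^ m) := by
    rw [hY, derivative_C_mul, eval₂_mul, Polynomial.eval₂_C]
    simp
  rw [hdY] at hroot
  refine h (τ.comp (seriesSubst a q hq)) (hτ.comp (seriesSubst_injective ha q hq))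
    (fun f hf => hloc _ ?_) _ ?_ hroot.1 ((mul_eq_zero.mp hroot.2).resolve_right hτX)
  · rw [constantCoeff_seriesSubst, hf]
  · rw [hY, eval₂_mul, Polynomial.eval₂_C, map_mul, hloc _ (by simp [hm.ne']), zero_mul]

/-- Zero would be a double root. This excludes Newton polygons reduced to a point. -/
theorem NoDoubleRoot.ne_X_pow {H : L⟦X⟧[X]} {n : ℕ} (hn : 1 < n) (h : NoDoubleRoot H) :
    H ≠ Polynomial.X ^ n := by
  rintro rfl
  refine h (RingHom.id _) Function.injective_id (fun f hf => hf) 0 (by simp) ?_ ?_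
  · simp only [eval₂_X_pow]
    exact zero_pow (by omega)
  · rw [derivative_X_pow, eval₂_mul, eval₂_X_pow, zero_pow (by omega), mul_zero]

end Substitution

end RationalPuiseux

end

noncomputable section

open Polynomial PowerSeries

namespace RationalPuiseux

/-! ### Newton polygons, edge data and their numerical consequences. -/

section NewtonPolygon

variable {L : Type*} [Field L]

/-- Supporting line: the half-plane above a non-vertical line through the point is convex, so it
contains the whole hull once it contains the exponents. -/
theorem mem_newtonPolygon_of_le {F : L⟦X⟧[X]} {i j : ℕ} (h : (F.coeff i).order = (j : ℕ∞))
    (a : ℝ) (ha : ∀ i' j' : ℕ, (F.coeff i').order = (j' : ℕ∞) →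
      a * i + j ≤ a * i' + j') :
    ((i : ℝ), (j : ℝ)) ∈ newtonPolygon F := by
  have hmem : ((i : ℝ), (j : ℝ)) ∈ newtonPoints F := ⟨i, j, h, rfl⟩
  refine ⟨subset_convexHull ℝ _ hmem, fun p' hp' h1 => ?_⟩
  have hsub : newtonPoints F ⊆ {p : ℝ × ℝ | a * i + j ≤ a * p.1 + p.2} := by
    rintro p ⟨i', j', h', rfl⟩
    exact ha i' j' h'
  have hconv : Convex ℝ {p : ℝ × ℝ | a * i + j ≤ a * p.1 + p.2} :=
    convex_halfSpace_ge
      (f := fun p : ℝ × ℝ => a * p.1 + p.2)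
      ⟨fun x y => by simp only [Prod.fst_add, Prod.snd_add]; ring,
        fun c x => by simp only [Prod.smul_fst, Prod.smul_snd, smul_eq_mul]; ring⟩ _
  have := convexHull_min hsub hconv hp'
  simp only [Set.mem_ofPred_eq, h1] at this
  simpa using this

theorem coeff_boundaryPolynomial (F : L⟦X⟧[X]) {i j : ℕ} (hi : i ≤ F.natDegree)
    (h : ((i : ℝ), (j : ℝ)) ∈ newtonPolygon F) :
    PowerSeries.coeff j ((boundaryPolynomial F).coeff i) = PowerSeries.coeff j (F.coeff i) := by
  classical
  rw [boundaryPolynomial, Polynomial.finsetSum_coeff, Finset.sum_eq_single i]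
  · simp [h]
  · intro b _ hb
    rw [Polynomial.coeff_monomial, if_neg hb]
  · intro hn
    exact absurd (Finset.mem_range.mpr (by omega)) hn

theorem natDegree_boundaryPolynomial_le (F : L⟦X⟧[X]) :
    (boundaryPolynomial F).natDegree ≤ F.natDegree := by
  refine natDegree_sum_le_of_forall_le _ _ fun i hi => ?_
  exact (natDegree_monomial_le _).trans (by simpa [Nat.lt_succ_iff] using hi)

theorem quasiHomogenization_eq_sum (q m : ℕ) (P : L[X]) :
    quasiHomogenization q m P = ∑ i ∈ Finset.range (P.natDegree + 1),
      Polynomial.monomial (q * i) (PowerSeries.monomial (m * (P.natDegree - i)) (P.coeff i)) :=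
  Polynomial.sum_over_range _ fun i => by simp

theorem natDegree_quasiHomogenization_le (q m : ℕ) (P : L[X]) :
    (quasiHomogenization q m P).natDegree ≤ q * P.natDegree := by
  rw [quasiHomogenization_eq_sum]
  refine natDegree_sum_le_of_forall_le _ _ fun i hi => ?_
  refine (natDegree_monomial_le _).trans (Nat.mul_le_mul_left _ ?_)
  simpa [Nat.lt_succ_iff] using hi

theorem coeff_quasiHomogenization {q : ℕ} (hq : 0 < q) (m : ℕ) {P : L[X]} (hP : P.Monic) :
    (quasiHomogenization q m P).coeff (q * P.natDegree) = 1 := by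
  rw [quasiHomogenization_eq_sum, Polynomial.finsetSum_coeff,
    Finset.sum_eq_single P.natDegree]
  · simp [hP.coeff_natDegree]
  · intro b _ hb
    rw [Polynomial.coeff_monomial, if_neg]
    exact fun h => hb (Nat.eq_of_mul_eq_mul_left hq h)
  · intro hn
    exact absurd (Finset.mem_range.mpr (by omega)) hn

theorem natDegree_quasiHomogenization {q : ℕ} (hq : 0 < q) (m : ℕ) {P : L[X]} (hP : P.Monic) :
    (quasiHomogenization q m P).natDegree = q * P.natDegree :=
  le_antisymm (natDegree_quasiHomogenization_le q m P)
    (le_natDegree_of_ne_zero (by rw [coeff_quasiHomogenization hq m hP]; exact one_ne_zero))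

theorem monic_quasiHomogenization {q : ℕ} (hq : 0 < q) (m : ℕ) {P : L[X]} (hP : P.Monic) :
    (quasiHomogenization q m P).Monic := by
  rw [Polynomial.Monic, leadingCoeff, natDegree_quasiHomogenization hq m hP,
    coeff_quasiHomogenization hq m hP]

theorem quasiHomogenization_X (q m : ℕ) :
    quasiHomogenization q m (Polynomial.X : L[X]) = Polynomial.X ^ q := by
  rw [quasiHomogenization_eq_sum, natDegree_X, Finset.sum_range_succ, Finset.sum_range_one]
  simp [Polynomial.X_pow_eq_monomial]

theorem IsWeierstrass.natDegree_mem_newtonPolygon {F : L⟦X⟧[X]} (hF : IsWeierstrass F) :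
    ((F.natDegree : ℝ), ((0 : ℕ) : ℝ)) ∈ newtonPolygon F := by
  refine mem_newtonPolygon_of_le (by rw [hF.1.coeff_natDegree]; simp) 0 fun i' j' _ => ?_
  simp

theorem IsWeierstrass.natDegree_boundaryPolynomial {F : L⟦X⟧[X]} (hF : IsWeierstrass F) :
    (boundaryPolynomial F).natDegree = F.natDegree := by
  refine le_antisymm (natDegree_boundaryPolynomial_le F) (le_natDegree_of_ne_zero fun h => ?_)
  have := coeff_boundaryPolynomial F le_rfl hF.natDegree_mem_newtonPolygon
  rw [h, hF.1.coeff_natDegree] at this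
  simp at this

/-- A Weierstrass polynomial that is not a power of `y` has a vertex to the left of its top one. -/
theorem IsWeierstrass.exists_left_vertex {F : L⟦X⟧[X]} (hF : IsWeierstrass F)
    (hne : F ≠ Polynomial.X ^ F.natDegree) :
    ∃ i j : ℕ, i < F.natDegree ∧ 0 < j ∧ (F.coeff i).order = (j : ℕ∞) ∧
      ((i : ℝ), (j : ℝ)) ∈ newtonPolygon F := by
  classical
  have hex : ∃ i, i < F.natDegree ∧ F.coeff i ≠ 0 := by
    by_contra! hcon
    refine hne (Polynomial.ext fun i => ?_)
    rw [Polynomial.coeff_X_pow]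
    rcases lt_trichotomy i F.natDegree with hi | rfl | hi
    · rw [hcon i hi, if_neg hi.ne]
    · rw [hF.1.coeff_natDegree, if_pos rfl]
    · rw [coeff_eq_zero_of_natDegree_lt hi, if_neg hi.ne']
  obtain ⟨hi, h0⟩ := Nat.find_spec hex
  set i := Nat.find hex with hidef
  obtain ⟨j, hj⟩ := ENat.ne_top_iff_exists.mp (PowerSeries.order_finite_iff_ne_zero.mpr h0).ne
  have hmin : ∀ i' < i, F.coeff i' = 0 := fun i' hi' => by
    by_contra h'
    exact Nat.find_min hex hi' ⟨hi'.trans hi, h'⟩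
  refine ⟨i, j, hi, Nat.pos_of_ne_zero ?_, hj.symm, ?_⟩
  · rintro rfl
    have h1 : (F.coeff i).order = ((0 : ℕ) : ℕ∞) := hj.symm
    rw [PowerSeries.order_eq_nat] at h1
    exact h1.1 (by rw [PowerSeries.coeff_zero_eq_constantCoeff_apply]; exact hF.2 i hi)
  -- Here `i` is the least index with nonzero coefficient. A supporting line of slope `-j` works:
  -- any other index is at least `i + 1`, which already contributes an extra `j`.
  · refine mem_newtonPolygon_of_le hj.symm j fun i' j' h' => ?_
    rcases lt_trichotomy i' i with hlt | rfl | hgt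
    · rw [hmin i' hlt, PowerSeries.order_zero] at h'
      exact absurd h' (ENat.top_ne_natCast _)
    · rw [← hj] at h'
      rw [Nat.cast_inj.mp h']
    · have : j * i + j ≤ j * i' + j' := by nlinarith
      exact_mod_cast this

variable {K E : Type*} [Field K] [Field E] [Algebra K E]

/-- Compare degrees in `y`: the boundary polynomial keeps the leading term, as `(deg F, 0)` is on
the polygon. -/
theorem IsEdgeData.natDegree_eq {k : IntermediateField K E} {F : E⟦X⟧[X]} {q m : ℕ} {P : E[X]}
    {N : ℕ} (h : IsEdgeData k F q m P N) (hF : IsWeierstrass F) :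
    F.natDegree = q * P.natDegree * N := by
  obtain ⟨c, hc, hb⟩ := h.boundary
  have hmon := monic_quasiHomogenization h.q_pos m h.monic
  rw [← hF.natDegree_boundaryPolynomial, hb, natDegree_C_mul, hmon.natDegree_pow,
    natDegree_quasiHomogenization h.q_pos m h.monic, mul_comm]
  simpa using hc

/-- With slope zero, the left vertex, at positive height, would be level with the end `(deg F, 0)`.
-/
theorem IsEdgeData.slope_pos {k : IntermediateField K E} {F : E⟦X⟧[X]} {q m : ℕ} {P : E[X]}
    {N : ℕ} (h : IsEdgeData k F q m P N) (hF : IsWeierstrass F)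
    (hne : F ≠ Polynomial.X ^ F.natDegree) : 0 < m := by
  obtain ⟨i, j, hi, hj, -, hmem⟩ := hF.exists_left_vertex hne
  refine Nat.pos_of_ne_zero ?_
  rintro rfl
  have := h.straight _ hmem _ hF.natDegree_mem_newtonPolygon
  simp [hj.ne', h.q_pos.ne'] at this

/-- A monic irreducible polynomial with root `0` is `Z`. The boundary polynomial would then be a
constant times a power of `y`, without the term of the left vertex. -/
theorem IsEdgeData.eval_zero_ne_zero {k : IntermediateField K E} {F : E⟦X⟧[X]} {q m : ℕ}
    {P : E[X]} {N : ℕ} (h : IsEdgeData k F q m P N) (hF : IsWeierstrass F)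
    (hne : F ≠ Polynomial.X ^ F.natDegree) : P.eval 0 ≠ 0 := by
  intro h0
  obtain ⟨p, hp, hpP⟩ := h.irreducible
  have hpmon : p.Monic := by
    have := h.monic
    rw [← hpP] at this
    exact monic_of_injective (algebraMap k E).injective this
  have hp0 : p.coeff 0 = 0 := by
    rw [← hpP, ← Polynomial.coeff_zero_eq_eval_zero, Polynomial.coeff_map] at h0
    simpa using h0
  have hpX : p = Polynomial.X :=
    (eq_of_monic_of_associated monic_X hpmon
      (irreducible_X.associated_of_dvd hp (Polynomial.X_dvd_iff.mpr hp0))).symm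
  have hPX : P = Polynomial.X := by rw [← hpP, hpX, Polynomial.map_X]
  obtain ⟨i, j, hi, hj, hord, hmem⟩ := hF.exists_left_vertex hne
  obtain ⟨c, hc, hb⟩ := h.boundary
  have hdeg := h.natDegree_eq hF
  have hco := coeff_boundaryPolynomial F hi.le hmem
  rw [hPX, natDegree_X, mul_one] at hdeg
  rw [hb, hPX, quasiHomogenization_X, ← pow_mul, ← hdeg, Polynomial.coeff_C_mul,
    Polynomial.coeff_X_pow, if_neg hi.ne, mul_zero, map_zero, eq_comm] at hco
  exact (PowerSeries.order_eq_nat.mp hord).1 hco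

end NewtonPolygon

/-! ### Initial forms with respect to `x`. -/

section InitialForms

variable {L : Type*} [Field L]

/-- `A = x ^ v B` with `B(0, y) = b(y)`. -/
def HasInitialForm (A : L⟦X⟧[X]) (v : ℕ) (b : L[X]) : Prop :=
  ∃ B : L⟦X⟧[X], A = Polynomial.C (PowerSeries.X ^ v) * B ∧
    B.map (PowerSeries.constantCoeff (R := L)) = b

theorem HasInitialForm.coeff {A : L⟦X⟧[X]} {v : ℕ} {b : L[X]} (h : HasInitialForm A v b) (i : ℕ) :
    PowerSeries.coeff v (A.coeff i) = b.coeff i := by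
  obtain ⟨B, rfl, rfl⟩ := h
  rw [Polynomial.coeff_C_mul, PowerSeries.coeff_X_pow_mul', if_pos le_rfl, Nat.sub_self,
    Polynomial.coeff_map, PowerSeries.coeff_zero_eq_constantCoeff_apply]

theorem HasInitialForm.xVal {A : L⟦X⟧[X]} {v : ℕ} {b : L[X]} (h : HasInitialForm A v b)
    (hb : b ≠ 0) : xVal A = v := by
  apply le_antisymm
  · obtain ⟨i, hi⟩ : ∃ i, b.coeff i ≠ 0 := by
      by_contra! hcon
      exact hb (Polynomial.ext hcon)
    refine (iInf_le _ i).trans (PowerSeries.order_le v ?_)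
    rwa [h.coeff]
  · refine le_iInf fun i => ?_
    obtain ⟨B, rfl, rfl⟩ := h
    rw [Polynomial.coeff_C_mul]
    refine le_trans ?_ (PowerSeries.le_order_mul _ _)
    rw [PowerSeries.order_X_pow]
    exact le_self_add

theorem HasInitialForm.xInitial {A : L⟦X⟧[X]} {v : ℕ} {b : L[X]} (h : HasInitialForm A v b)
    (hb : b ≠ 0) : xInitial A = b.trailingCoeff := by
  have hsum : (∑ i ∈ Finset.range (A.natDegree + 1),
      Polynomial.monomial i (PowerSeries.coeff v (A.coeff i))) = b := by
    ext n
    rw [Polynomial.finsetSum_coeff, ← h.coeff n]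
    simp only [Polynomial.coeff_monomial]
    rw [Finset.sum_ite_eq']
    split_ifs with hn
    · rfl
    · rw [coeff_eq_zero_of_natDegree_lt (by simpa using hn), map_zero]
  rw [RationalPuiseux.xInitial, h.xVal hb, ENat.toNat_natCast, hsum]

theorem HasInitialForm.mul {A A' : L⟦X⟧[X]} {v v' : ℕ} {b b' : L[X]} (h : HasInitialForm A v b)
    (h' : HasInitialForm A' v' b') : HasInitialForm (A * A') (v + v') (b * b') := by
  obtain ⟨B, rfl, rfl⟩ := h
  obtain ⟨B', rfl, rfl⟩ := h'
  exact ⟨B * B', by rw [pow_add, Polynomial.C_mul]; ring, by rw [Polynomial.map_mul]⟩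

theorem HasInitialForm.pow {A : L⟦X⟧[X]} {v : ℕ} {b : L[X]} (h : HasInitialForm A v b) (n : ℕ) :
    HasInitialForm (A ^ n) (n * v) (b ^ n) := by
  obtain ⟨B, rfl, rfl⟩ := h
  refine ⟨B ^ n, ?_, by rw [Polynomial.map_pow]⟩
  rw [mul_pow, ← Polynomial.C_pow, ← pow_mul, mul_comm v n]

theorem HasInitialForm.sum {ι : Type*} (J : Finset ι) {A : ι → L⟦X⟧[X]} {v : ι → ℕ} {b : ι → L[X]}
    (h : ∀ i ∈ J, HasInitialForm (A i) (v i) (b i)) {w : ℕ} (hw : ∀ i ∈ J, w ≤ v i) :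
    HasInitialForm (∑ i ∈ J, A i) w (∑ i ∈ J with v i = w, b i) := by
  classical
  choose! B hB hb using h
  refine ⟨∑ i ∈ J, Polynomial.C (PowerSeries.X ^ (v i - w)) * B i, ?_, ?_⟩
  · rw [Finset.mul_sum]
    refine Finset.sum_congr rfl fun i hi => ?_
    rw [hB i hi, ← mul_assoc, ← Polynomial.C_mul, ← pow_add, Nat.add_sub_cancel' (hw i hi)]
  · rw [Polynomial.map_sum, Finset.sum_filter]
    refine Finset.sum_congr rfl fun i hi => ?_
    rw [Polynomial.map_mul, Polynomial.map_C, hb i hi, map_pow, PowerSeries.constantCoeff_X]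
    split_ifs with hv
    · simp [hv]
    · rw [zero_pow (by have := hw i hi; omega), Polynomial.C_0, zero_mul]

/-- The effect of `(x, y) ↦ (a x ^ q, x ^ m (y + β(x)))` on the initial form of a polynomial that is
a unit in `L[[x, y]]`. -/
theorem HasInitialForm.substHom {A : L⟦X⟧[X]} {v : ℕ} {b : L[X]} (h : HasInitialForm A v b)
    (a : L) {q m : ℕ} (hq : q ≠ 0) (hm : 0 < m) (Y : L⟦X⟧[X]) :
    HasInitialForm (substHom a q hq (Polynomial.C (PowerSeries.X ^ m) * Y) A) (q * v)
      (Polynomial.C (a ^ v * b.coeff 0)) := by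
  obtain ⟨B, rfl, rfl⟩ := h
  refine ⟨Polynomial.C (PowerSeries.C (a ^ v)) *
    RationalPuiseux.substHom a q hq (Polynomial.C (PowerSeries.X ^ m) * Y) B, ?_, ?_⟩
  · rw [map_mul, substHom_C, map_pow, seriesSubst_X, mul_pow, ← pow_mul, Polynomial.C_mul,
      ← map_pow PowerSeries.C]
    ring
  · rw [Polynomial.map_mul, Polynomial.map_C, Polynomial.C_mul, PowerSeries.constantCoeff_C,
      Polynomial.coeff_map]
    congr 1
    -- Modulo `x` the substitution sends `y` to `0`, as `m > 0`, and a series to its constant term;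
    -- only `B(0, 0)` survives.
    have : (Polynomial.mapRingHom (PowerSeries.constantCoeff (R := L))).comp
        (RationalPuiseux.substHom a q hq (Polynomial.C (PowerSeries.X ^ m) * Y)) =
        (Polynomial.C.comp (PowerSeries.constantCoeff (R := L))).comp
          Polynomial.constantCoeff := by
      refine Polynomial.ringHom_ext (fun f => ?_) ?_
      · simp [substHom_C, constantCoeff_seriesSubst]
      · simp [substHom_X, hm.ne']
    exact DFunLike.congr_fun this B

end InitialForms

end RationalPuiseux

end

noncomputable section

open Polynomial PowerSeries

namespace RationalPuiseux

/-! ### Adic expansions and residual polynomials of sums. -/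

section Expansion

/-- The `φ`-adic expansion of a polynomial. -/
theorem exists_adic_expansion {R : Type*} [CommRing R] {φ : R[X]} (hφ : φ.Monic)
    {d : ℕ} (hd : φ.natDegree = d) (n : ℕ) :
    ∀ a : R[X], a.degree < ((n * d : ℕ) : WithBot ℕ) →
      ∃ f : ℕ → R[X], (∀ i, (f i).degree < (d : WithBot ℕ)) ∧
        a = ∑ i ∈ Finset.range n, f i * φ ^ i := by
  nontriviality R
  have hdeg : φ.degree = (d : WithBot ℕ) := by rw [degree_eq_natDegree hφ.ne_zero, hd]
  induction n with
  | zero =>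
    intro a ha
    refine ⟨0, fun i => by simp, ?_⟩
    simpa [Polynomial.degree_eq_bot] using ha
  | succ n ih =>
    intro a ha
    have hdiv : (a /ₘ φ).degree < ((n * d : ℕ) : WithBot ℕ) := by
      by_cases h : φ.degree ≤ a.degree
      · have hadd := degree_add_divByMonic hφ h
        have hne : a /ₘ φ ≠ 0 := by
          rw [Ne, divByMonic_eq_zero_iff hφ]
          exact not_lt.mpr h
        rw [← hadd, hdeg, degree_eq_natDegree hne, ← Nat.cast_add, Nat.cast_lt, add_mul,
          one_mul] at ha
        rw [degree_eq_natDegree hne, Nat.cast_lt]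
        omega
      · rw [(divByMonic_eq_zero_iff hφ).mpr (not_le.mp h), degree_zero]
        exact WithBot.bot_lt_coe _
    obtain ⟨f, hf, hsum⟩ := ih _ hdiv
    refine ⟨fun i => if i = 0 then a %ₘ φ else f (i - 1), fun i => ?_, ?_⟩
    · dsimp only
      split_ifs
      · rw [← hdeg]; exact degree_modByMonic_lt a hφ
      · exact hf _
    · rw [Finset.sum_range_succ']
      simp only [Nat.add_eq_zero_iff, one_ne_zero, and_false, if_false, if_true, pow_zero, mul_one,
        Nat.add_sub_cancel]
      conv_lhs => rw [← modByMonic_add_div a φ, hsum, Finset.mul_sum, add_comm]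
      congr 1
      exact Finset.sum_congr rfl fun i _ => by rw [pow_succ]; ring

end Expansion

section Residual

variable {K E : Type*} [Field K] [Field E] [Algebra K E]

/-- The terms of minimal weight `q e_i + m i` of a sum combine into a polynomial in
`(y + z ^ s) ^ q / z ^ (t m)`. -/
theorem exists_initialForm_sum (k : IntermediateField K E) {J : Finset ℕ} (hJ : J.Nonempty)
    (e : ℕ → ℕ) (γ : ℕ → E) (hγ : ∀ i ∈ J, γ i ∈ k) (hγ0 : ∀ i ∈ J, γ i ≠ 0)
    (A : ℕ → E⟦X⟧[X]) {q m t s : ℕ} (hq : 0 < q) (hqm : Nat.Coprime q m)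
    {z : E} (hz : z ≠ 0)
    (hA : ∀ i ∈ J, HasInitialForm (A i) (q * e i + m * i)
      (Polynomial.C (z ^ (t * e i) * γ i) * (Polynomial.X + Polynomial.C (z ^ s)) ^ i)) :
    ∃ (i₀ e₀ : ℕ) (Q : k[X]), Q ≠ 0 ∧
      (∀ j, Q.coeff j ≠ 0 → i₀ + q * j ∈ J ∧ γ (i₀ + q * j) = Q.coeff j ∧
        e (i₀ + q * j) + m * j = e₀) ∧
      HasInitialForm (∑ i ∈ J, A i) (q * e₀ + m * i₀)
        (Polynomial.C (z ^ (t * e₀)) * (Polynomial.X + Polynomial.C (z ^ s)) ^ i₀ *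
          (Q.map (algebraMap k E)).comp
            (Polynomial.C (z ^ (t * m))⁻¹ * (Polynomial.X + Polynomial.C (z ^ s)) ^ q)) := by
  classical
  obtain ⟨i₁, hi₁, hmin⟩ := J.exists_min_image (fun i => q * e i + m * i) hJ
  set w := q * e i₁ + m * i₁ with hw
  set Jw := J.filter (fun i => q * e i + m * i = w) with hJw
  have hJwne : Jw.Nonempty := ⟨i₁, Finset.mem_filter.mpr ⟨hi₁, rfl⟩⟩
  set i₀ := Jw.min' hJwne with hi₀
  have hi₀mem : i₀ ∈ Jw := Finset.min'_mem _ _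
  have hi₀w : q * e i₀ + m * i₀ = w := (Finset.mem_filter.mp hi₀mem).2
  -- Equal weights give `q ∣ m (i - i₀)`, hence `q ∣ i - i₀` by coprimality; each step of `q` in the
  -- index lowers `e` by `m`.
  have hform : ∀ i ∈ Jw, ∃ j, i = i₀ + q * j ∧ e i + m * j = e i₀ := by
    intro i hi
    have hle : i₀ ≤ i := Finset.min'_le _ _ hi
    have hiw : q * e i + m * i = w := (Finset.mem_filter.mp hi).2
    obtain ⟨r, rfl⟩ := Nat.exists_eq_add_of_le hle
    have h1 : q * e i₀ = q * e (i₀ + r) + m * r := by nlinarith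
    have h2 : q ∣ m * r := (Nat.dvd_add_right ⟨e (i₀ + r), rfl⟩).mp ⟨e i₀, h1.symm⟩
    obtain ⟨j, rfl⟩ := hqm.dvd_of_dvd_mul_left h2
    refine ⟨j, rfl, Nat.eq_of_mul_eq_mul_left hq ?_⟩
    rw [h1]; ring
  have hidx : ∀ j, (i₀ + q * j - i₀) / q = j := fun j => by
    rw [Nat.add_sub_cancel_left, Nat.mul_div_cancel_left _ hq]
  set Q : k[X] := ∑ i ∈ Jw.attach, Polynomial.monomial ((i.1 - i₀) / q)
    (⟨γ i.1, hγ i.1 (Finset.mem_filter.mp i.2).1⟩ : k) with hQ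
  have hQc : ∀ j, ((Q.coeff j : k) : E) = if i₀ + q * j ∈ Jw then γ (i₀ + q * j) else 0 := by
    intro j
    have h1 : ((Q.coeff j : k) : E) = ∑ i ∈ Jw, if (i - i₀) / q = j then γ i else 0 := by
      rw [hQ, Polynomial.finsetSum_coeff, ← Finset.sum_attach Jw]
      rw [AddSubmonoidClass.coe_finsetSum]
      refine Finset.sum_congr rfl fun i _ => ?_
      rw [Polynomial.coeff_monomial]
      split_ifs <;> rfl
    rw [h1]
    split_ifs with hj
    · rw [Finset.sum_eq_single (i₀ + q * j), if_pos (hidx j)]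
      · intro i hi hne
        obtain ⟨j', rfl, -⟩ := hform i hi
        rw [hidx, if_neg]
        rintro rfl
        exact hne rfl
      · exact fun h => absurd hj h
    · refine Finset.sum_eq_zero fun i hi => ?_
      obtain ⟨j', rfl, -⟩ := hform i hi
      rw [hidx, if_neg]
      rintro rfl
      exact hj hi
  refine ⟨i₀, e i₀, Q, ?_, ?_, ?_⟩
  · intro h0
    have := hQc 0
    rw [h0, mul_zero, add_zero, if_pos hi₀mem] at this
    exact hγ0 i₀ (Finset.mem_filter.mp hi₀mem).1 (by simpa using this.symm)
  · intro j hj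
    have hjc := hQc j
    have hmem : i₀ + q * j ∈ Jw := by
      by_contra hcon
      rw [if_neg hcon] at hjc
      exact hj (by simpa using hjc)
    rw [if_pos hmem] at hjc
    obtain ⟨j', hj', hej'⟩ := hform _ hmem
    have : j = j' := Nat.eq_of_mul_eq_mul_left hq (Nat.add_left_cancel hj')
    subst this
    exact ⟨(Finset.mem_filter.mp hmem).1, hjc.symm, hej'⟩
  · have hsum := HasInitialForm.sum J hA hmin
    rw [hi₀w]
    convert hsum using 1
    rw [← hJw, hQ, Polynomial.map_sum, Polynomial.sum_comp, Finset.mul_sum,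
      ← Finset.sum_attach Jw]
    refine Finset.sum_congr rfl fun i _ => ?_
    obtain ⟨j, hij, hej⟩ := hform i.1 i.2
    -- The drop of `e` by `m j` changes the power of `z` by exactly the `j`-th power of the scalar
    -- in the argument of `Q`.
    have hzj : z ^ (t * e i₀) * ((z ^ (t * m))⁻¹) ^ j = z ^ (t * e i.1) := by
      rw [← hej, mul_add, pow_add, inv_pow, ← pow_mul, mul_assoc t m j]
      field_simp
    have hidx' : (i.1 - i₀) / q = j := by rw [hij, hidx]
    rw [Polynomial.map_monomial, Polynomial.monomial_comp, hidx', ← hzj, mul_pow]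
    simp only [Polynomial.C_mul, Polynomial.C_pow]
    have hg : algebraMap k E ⟨γ i.1, hγ i.1 (Finset.mem_filter.mp i.2).1⟩ = γ i.1 := rfl
    have hpow : ∀ W : E[X], W ^ i.1 = W ^ i₀ * (W ^ q) ^ j := fun W => by
      rw [hij, pow_add, pow_mul]
    rw [hg, hpow]
    ring

/-- An irreducible monic polynomial with root `z` is the minimal polynomial of `z` over `k`. -/
theorem dvd_of_eval_eq_zero {k : IntermediateField K E} {P : E[X]} {p Q : k[X]}
    (hp : Irreducible p) (hpP : p.map (algebraMap k E) = P) (hP : P.Monic) {z : E}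
    (hz : P.eval z = 0) (hQ : (Q.map (algebraMap k E)).eval z = 0) : p ∣ Q := by
  have hpm : p.Monic := monic_of_injective (algebraMap k E).injective (by rwa [hpP])
  have hmin : p = minpoly k z := by
    refine minpoly.eq_of_irreducible_of_monic hp ?_ hpm
    rw [← hpP, eval_map] at hz
    exact hz
  rw [hmin]
  refine minpoly.dvd k z ?_
  rw [eval_map] at hQ
  exact hQ

theorem HasInitialForm.unique {L : Type*} [Field L] {A : L⟦X⟧[X]} {v v' : ℕ} {b b' : L[X]}
    (h : HasInitialForm A v b) (h' : HasInitialForm A v' b') (hb : b ≠ 0) (hb' : b' ≠ 0) :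
    v = v' ∧ b = b' := by
  have hv : v = v' := by
    have := (h.xVal hb).symm.trans (h'.xVal hb')
    exact_mod_cast this
  subst hv
  exact ⟨rfl, Polynomial.ext fun i => by rw [← h.coeff, ← h'.coeff]⟩

theorem HasInitialForm.one {L : Type*} [Field L] : HasInitialForm (1 : L⟦X⟧[X]) 0 1 :=
  ⟨1, by simp, by simp⟩

end Residual

end RationalPuiseux

end

noncomputable section

open Polynomial PowerSeries

namespace RationalPuiseux

/-! ### One step of the induction, for an abstract pull-back `θ` followed by `σ`. -/

section Step

variable {K E : Type*} [Field K] [Field E] [Algebra K E]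

/-- The properties of a substitution `σ(x, y) = (z ^ t x ^ q, x ^ m (y + z ^ s + c(x)))` with
`c(0) = 0` and `z` a root of the irreducible polynomial `P` over `k`. -/
structure IsStep (k : IntermediateField K E) (σ : E⟦X⟧[X] →+* E⟦X⟧[X]) (q m t s : ℕ) (z : E)
    (P : E[X]) : Prop where
  q_pos : 0 < q
  m_pos : 0 < m
  bezout : q * s = t * m + 1
  z_ne_zero : z ≠ 0
  monic : P.Monic
  irreducible : ∃ p : k[X], Irreducible p ∧ p.map (algebraMap k E) = P
  root : P.eval z = 0
  unit : ∀ A v b, HasInitialForm A v b →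
    HasInitialForm (σ A) (q * v) (Polynomial.C ((z ^ t) ^ v * b.coeff 0))
  var : HasInitialForm (σ Polynomial.X) m (Polynomial.X + Polynomial.C (z ^ s))

/-- Polynomials of degree less than `d` pull back to monomials times units. -/
def IsUnitBelow (θ : K⟦X⟧[X] →+* E⟦X⟧[X]) (d : ℕ) : Prop :=
  ∀ a, a ≠ 0 → a.degree < (d : WithBot ℕ) →
    ∃ v b, HasInitialForm (θ a) v b ∧ b.coeff 0 ≠ 0

variable {k : IntermediateField K E} {σ : E⟦X⟧[X] →+* E⟦X⟧[X]} {q m t s : ℕ} {z : E} {P : E[X]}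
  {θ : K⟦X⟧[X] →+* E⟦X⟧[X]}

theorem IsStep.coprime (h : IsStep k σ q m t s z P) : Nat.Coprime q m := by
  refine Nat.Coprime.symm (Nat.coprime_of_dvd fun p hp h1 h2 => ?_)
  have : p ∣ t * m + 1 := h.bezout ▸ (h2.mul_right s)
  have := (Nat.dvd_add_right (h1.mul_left t)).mp this
  exact hp.one_lt.ne' (Nat.dvd_one.mp this)

/-- This is the purpose of the choice of `s` and `t`: the argument of the residual polynomial at `y
= 0` is `z` itself. -/
theorem IsStep.eval_eq (h : IsStep k σ q m t s z P) : (z ^ (t * m))⁻¹ * (z ^ s) ^ q = z := by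
  have hz := h.z_ne_zero
  rw [← pow_mul, mul_comm s q, h.bezout, pow_succ, inv_mul_cancel_left₀ (pow_ne_zero _ hz)]

theorem IsStep.pullback_var_mul (h : IsStep k σ q m t s z P) {U : E⟦X⟧[X]} {α : ℕ} {b : E[X]}
    (hU : HasInitialForm U α b) :
    HasInitialForm (σ (Polynomial.X * U)) (q * α + m)
      (Polynomial.C ((z ^ t) ^ α * b.coeff 0) * (Polynomial.X + Polynomial.C (z ^ s))) := by
  rw [map_mul, add_comm, mul_comm (Polynomial.C _)]
  exact h.var.mul (h.unit _ _ _ hU)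

/-- Each `θ (f i)` is a monomial times a unit, so `σ (θ (f i * φ ^ i))` has initial form a scalar
times `(y + z^s)^i`, and `exists_initialForm_sum` applies. The clause on digits equal to `1` is
meant for the top digit of a monic polynomial: it gives the leading coefficient of `Q` and the
weight. -/
theorem IsStep.pullback_expansion (h : IsStep k σ q m t s z P)
    (hθ : ∀ A i j, PowerSeries.coeff j ((θ A).coeff i) ∈ k) {d : ℕ} (hd : IsUnitBelow θ d)
    {φ : K⟦X⟧[X]} {U : E⟦X⟧[X]} (hφ : θ φ = Polynomial.X * U) {α : ℕ} {b : E[X]}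
    (hU : HasInitialForm U α b) (hb : b.coeff 0 ≠ 0)
    {n : ℕ} {f : ℕ → K⟦X⟧[X]} (hf : ∀ i < n, f i ≠ 0 → f i = 1 ∨ (f i).degree < (d : WithBot ℕ))
    (hne : ∃ i < n, f i ≠ 0) :
    ∃ (i₀ e₀ : ℕ) (Q : k[X]), Q ≠ 0 ∧
      (∀ j, Q.coeff j ≠ 0 → i₀ + q * j < n ∧ (f (i₀ + q * j) = 1 →
        (Q.coeff j : E) = b.coeff 0 ^ (i₀ + q * j) ∧ (i₀ + q * j) * α + m * j = e₀)) ∧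
      HasInitialForm (σ (θ (∑ i ∈ Finset.range n, f i * φ ^ i))) (q * e₀ + m * i₀)
        (Polynomial.C (z ^ (t * e₀)) * (Polynomial.X + Polynomial.C (z ^ s)) ^ i₀ *
          (Q.map (algebraMap k E)).comp
            (Polynomial.C (z ^ (t * m))⁻¹ * (Polynomial.X + Polynomial.C (z ^ s)) ^ q)) := by
  classical
  set J := (Finset.range n).filter (fun i => f i ≠ 0) with hJ
  have hJmem : ∀ i ∈ J, i < n ∧ f i ≠ 0 := fun i hi => by simpa [hJ] using hi
  have hJne : J.Nonempty := by
    obtain ⟨i, hi, hi'⟩ := hne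
    exact ⟨i, by simp [hJ, hi, hi']⟩
  have hex : ∀ i, ∃ v b, i ∈ J → HasInitialForm (θ (f i)) v b ∧ b.coeff 0 ≠ 0 := by
    intro i
    by_cases hi : i ∈ J
    · rcases hf i (hJmem i hi).1 (hJmem i hi).2 with h1 | h1
      · exact ⟨0, 1, fun _ => ⟨by rw [h1, map_one]; exact HasInitialForm.one, by simp⟩⟩
      · obtain ⟨v, b, hvb⟩ := hd (f i) (hJmem i hi).2 h1
        exact ⟨v, b, fun _ => hvb⟩
    · exact ⟨0, 0, fun h => absurd h hi⟩
  choose v c hvc using hex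
  -- The constant term of the initial form of `U` is the coefficient of `x ^ α y` in `θ φ`, hence
  -- lies in `k`.
  have hβ : b.coeff 0 ∈ k := by
    have := hθ φ 1 α
    rwa [hφ, Polynomial.coeff_X_mul, hU.coeff] at this
  have hsum : σ (θ (∑ i ∈ Finset.range n, f i * φ ^ i)) = ∑ i ∈ J, σ (θ (f i * φ ^ i)) := by
    rw [map_sum, map_sum, hJ, Finset.sum_filter_of_ne]
    intro i _ hi h0
    exact hi (by rw [h0, zero_mul, map_zero, map_zero])
  rw [hsum]
  have hterm : ∀ i ∈ J, HasInitialForm (σ (θ (f i * φ ^ i))) (q * (v i + i * α) + m * i)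
      (Polynomial.C (z ^ (t * (v i + i * α)) * ((c i).coeff 0 * b.coeff 0 ^ i)) *
        (Polynomial.X + Polynomial.C (z ^ s)) ^ i) := by
    intro i hi
    have h1 := (h.unit _ _ _ ((hvc i hi).1.mul (hU.pow i))).mul (h.var.pow i)
    have hσ : σ (θ (f i * φ ^ i)) = σ (θ (f i) * U ^ i) * σ Polynomial.X ^ i := by
      rw [map_mul, map_pow, hφ, ← map_pow, ← map_mul]
      congr 1
      ring
    rw [hσ, mul_comm m i]
    rwa [Polynomial.mul_coeff_zero, Polynomial.coeff_zero_eq_eval_zero (b ^ i), eval_pow,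
      ← Polynomial.coeff_zero_eq_eval_zero, ← pow_mul] at h1
  obtain ⟨i₀, e₀, Q, hQ, hcoef, hform⟩ := exists_initialForm_sum k hJne (fun i => v i + i * α)
    (fun i => (c i).coeff 0 * b.coeff 0 ^ i)
    (fun i hi => k.mul_mem (by rw [← (hvc i hi).1.coeff]; exact hθ _ _ _) (pow_mem hβ i))
    (fun i hi => mul_ne_zero (hvc i hi).2 (pow_ne_zero _ hb))
    (fun i => σ (θ (f i * φ ^ i))) h.q_pos h.coprime h.z_ne_zero hterm
  refine ⟨i₀, e₀, Q, hQ, fun j hj => ?_, hform⟩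
  obtain ⟨hmem, hγ, he⟩ := hcoef j hj
  refine ⟨(hJmem _ hmem).1, fun h1 => ?_⟩
  have hvc1 := hvc _ hmem
  rw [h1, map_one] at hvc1
  obtain ⟨hv0, hc0⟩ := hvc1.1.unique HasInitialForm.one
    (fun h0 => hvc1.2 (by rw [h0, Polynomial.coeff_zero])) one_ne_zero
  rw [hc0, Polynomial.coeff_one_zero, one_mul] at hγ
  rw [hv0, zero_add] at he
  exact ⟨hγ.symm, he⟩

/-- The constant term is a power of `z` times `Q(z)`. If it vanished, `P` would divide `Q`, but the
indices of the expansion stay below `q deg P`, so `deg Q < deg P`. -/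
theorem IsStep.isUnitBelow (h : IsStep k σ q m t s z P)
    (hθ : ∀ A i j, PowerSeries.coeff j ((θ A).coeff i) ∈ k) {d : ℕ} (hd : IsUnitBelow θ d)
    {φ : K⟦X⟧[X]} (hmon : φ.Monic) (hdeg : φ.natDegree = d) {U : E⟦X⟧[X]}
    (hφ : θ φ = Polynomial.X * U) {α : ℕ} {b : E[X]}
    (hU : HasInitialForm U α b) (hb : b.coeff 0 ≠ 0) :
    IsUnitBelow (σ.comp θ) (q * P.natDegree * d) := by
  intro a ha hadeg
  obtain ⟨f, hf, rfl⟩ := exists_adic_expansion hmon hdeg (q * P.natDegree) a hadeg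
  have hne : ∃ i < q * P.natDegree, f i ≠ 0 := by
    by_contra! hcon
    exact ha (Finset.sum_eq_zero fun i hi => by rw [hcon i (Finset.mem_range.mp hi), zero_mul])
  obtain ⟨i₀, e₀, Q, hQ, hcoef, hform⟩ := h.pullback_expansion hθ hd hφ hU hb
    (fun i _ _ => Or.inr (hf i)) hne
  refine ⟨_, _, hform, ?_⟩
  have hlt := (hcoef Q.natDegree (by rwa [coeff_natDegree, leadingCoeff_ne_zero])).1
  rw [Polynomial.coeff_zero_eq_eval_zero]
  simp only [eval_mul, eval_comp, eval_pow, eval_add, eval_X, eval_C, zero_add]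
  rw [h.eval_eq]
  have hz := h.z_ne_zero
  refine mul_ne_zero (mul_ne_zero (pow_ne_zero _ hz) (pow_ne_zero _ (pow_ne_zero _ hz)))
    fun h0 => ?_
  obtain ⟨p, hp, hpP⟩ := h.irreducible
  have hdvd := dvd_of_eval_eq_zero hp hpP h.monic h.root h0
  have hle := natDegree_le_of_dvd hdvd hQ
  rw [← hpP, natDegree_map] at hlt
  have := Nat.mul_le_mul_left q hle
  omega

/-- Vanishing at `y = 0` forces `P ∣ Q`, and the indices, now at most `q deg P`, leave only `i₀ = 0`
and `deg Q = deg P`. The top digit `1` gives the leading coefficient, so `Q = β^{q deg P} P` with `β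
= b.coeff 0`. The constant term of `U'` is the derivative of the resulting initial form at `y = 0`.
-/
theorem IsStep.pullback_monic (h : IsStep k σ q m t s z P)
    (hθ : ∀ A i j, PowerSeries.coeff j ((θ A).coeff i) ∈ k) {d : ℕ} (hd : IsUnitBelow θ d)
    {φ : K⟦X⟧[X]} (hmon : φ.Monic) (hdeg : φ.natDegree = d) {U : E⟦X⟧[X]}
    (hφ : θ φ = Polynomial.X * U) {α : ℕ} {b : E[X]}
    (hU : HasInitialForm U α b) (hb : b.coeff 0 ≠ 0)
    {φ' : K⟦X⟧[X]} (hmon' : φ'.Monic) (hdeg' : φ'.natDegree = q * P.natDegree * d)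
    (hroot : (σ (θ φ')).eval 0 = 0) :
    ∃ (U' : E⟦X⟧[X]) (b' : E[X]), σ (θ φ') = Polynomial.X * U' ∧
      HasInitialForm U' (q * P.natDegree * (q * α + m)) b' ∧
      b'.coeff 0 = q * z ^ (1 - (s : ℤ) - (P.natDegree : ℤ)) * P.derivative.eval z *
        (b.coeff 0 * z ^ (t * α + s)) ^ (q * P.natDegree) := by
  have hz := h.z_ne_zero
  obtain ⟨p, hp, hpP⟩ := h.irreducible
  have hpm : p.Monic := monic_of_injective (algebraMap k E).injective (hpP ▸ h.monic)
  have hpdeg : p.natDegree = P.natDegree := by rw [← hpP, natDegree_map]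
  set n := q * P.natDegree with hn
  have hsub : (φ' - φ ^ n).degree < ((n * d : ℕ) : WithBot ℕ) := by
    have hd1 : φ'.degree = ((n * d : ℕ) : WithBot ℕ) := by
      rw [degree_eq_natDegree hmon'.ne_zero, hdeg']
    have hd2 : (φ ^ n).degree = ((n * d : ℕ) : WithBot ℕ) := by
      rw [degree_eq_natDegree (hmon.pow n).ne_zero, hmon.natDegree_pow, hdeg]
    rw [← hd1]
    exact degree_sub_lt_left (hd1.trans hd2.symm) hmon'.ne_zero
      (by rw [hmon'.leadingCoeff, (hmon.pow n).leadingCoeff])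
  obtain ⟨f, hf, hfsum⟩ := exists_adic_expansion hmon hdeg n _ hsub
  -- Subtracting `φ ^ n` brought the degree below `n d`; the digit `1` is put back at index `n`.
  set f' : ℕ → K⟦X⟧[X] := fun i => if i = n then 1 else f i with hf'
  have hf'n : f' n = 1 := by simp [hf']
  have hφ' : φ' = ∑ i ∈ Finset.range (n + 1), f' i * φ ^ i := by
    rw [Finset.sum_range_succ, hf'n, one_mul, ← sub_eq_iff_eq_add, hfsum]
    refine Finset.sum_congr rfl fun i hi => ?_
    rw [hf']
    dsimp only
    rw [if_neg (Finset.mem_range.mp hi).ne]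
  obtain ⟨i₀, e₀, Q, hQ, hcoef, hform⟩ := h.pullback_expansion hθ hd hφ hU hb (n := n + 1)
    (f := f') (fun i _ _ => by
      by_cases hi : i = n
      · exact Or.inl (by rw [hi, hf'n])
      · exact Or.inr (by simpa [hf', hi] using hf i))
    ⟨n, Nat.lt_succ_self n, by rw [hf'n]; exact one_ne_zero⟩
  rw [← hφ'] at hform
  have hb0 := hform.coeff 0
  rw [Polynomial.coeff_zero_eq_eval_zero, hroot, map_zero, Polynomial.coeff_zero_eq_eval_zero]
    at hb0
  simp only [eval_mul, eval_comp, eval_pow, eval_add, eval_X, eval_C, zero_add] at hb0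
  rw [h.eval_eq, eq_comm, mul_eq_zero] at hb0
  have hQz := hb0.resolve_left
    (mul_ne_zero (pow_ne_zero _ hz) (pow_ne_zero _ (pow_ne_zero _ hz)))
  have hdvd := dvd_of_eval_eq_zero hp hpP h.monic h.root hQz
  have hle := natDegree_le_of_dvd hdvd hQ
  have hlead : Q.coeff Q.natDegree ≠ 0 := by rwa [coeff_natDegree, leadingCoeff_ne_zero]
  have hlt := (hcoef _ hlead).1
  have hmul := Nat.mul_le_mul_left q hle
  rw [hpdeg, ← hn] at hmul
  have hi₀ : i₀ = 0 := by omega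
  have hQdeg : Q.natDegree = P.natDegree :=
    Nat.eq_of_mul_eq_mul_left h.q_pos (by omega)
  subst hi₀
  have hfac := (hcoef _ hlead).2
  rw [hQdeg, ← hn, zero_add] at hfac
  obtain ⟨hγ, he₀⟩ := hfac hf'n
  have hQeq : Q.map (algebraMap k E) = Polynomial.C (b.coeff 0 ^ n) * P := by
    obtain ⟨r, hr⟩ := hdvd
    have hr0 : r ≠ 0 := by rintro rfl; exact hQ (by rw [hr, mul_zero])
    have hrdeg : r.natDegree = 0 := by
      have := hpm.natDegree_mul' hr0
      rw [← hr] at this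
      omega
    obtain ⟨r₀, rfl⟩ := natDegree_eq_zero.mp hrdeg
    have hr₀ : algebraMap k E r₀ = b.coeff 0 ^ n := by
      rw [← hγ, hr, Polynomial.coeff_mul_C, ← hpdeg, hpm.coeff_natDegree, one_mul]
      rfl
    rw [hr, Polynomial.map_mul, Polynomial.map_C, hpP, hr₀, mul_comm]
  obtain ⟨B, hB, hBb⟩ := hform
  have hB0 : B.coeff 0 = 0 := by
    rw [hB, eval_mul, eval_C, mul_eq_zero] at hroot
    rw [Polynomial.coeff_zero_eq_eval_zero]
    exact hroot.resolve_left (pow_ne_zero _ PowerSeries.X_ne_zero)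
  obtain ⟨B', rfl⟩ := Polynomial.X_dvd_iff.mpr hB0
  have hw : q * e₀ + m * 0 = n * (q * α + m) := by
    rw [← he₀, hn]; ring
  refine ⟨Polynomial.C (PowerSeries.X ^ (q * e₀ + m * 0)) * B', _, by rw [hB]; ring,
    ⟨B', by rw [hw], rfl⟩, ?_⟩
  -- The derivative of `y B'` at `y = 0` is `B'(0)`; the chain rule on the other side yields
  -- `P'(z)`, the factor `q` and powers of `z`.
  have hd1 := congr_arg (fun p => (derivative p).eval 0) hBb
  rw [hQeq] at hd1
  simp only [Polynomial.map_mul, Polynomial.map_X, derivative_mul, Polynomial.derivative_X, pow_zero, mul_one,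
    Polynomial.derivative_C, zero_mul, zero_add, derivative_comp, Polynomial.derivative_pow, derivative_add,
    add_zero, eval_add, eval_mul, eval_X, one_mul, eval_C, eval_comp, eval_pow, mul_comp,
    C_comp, ← Polynomial.coeff_zero_eq_eval_zero (B'.map _)] at hd1
  rw [hd1, h.eval_eq]
  -- Here `e₀ = n α + m deg P` with `n = q deg P`; replacing `t m` by `q s - 1` turns the left
  -- exponent into the right one.
  have hexp : z ^ (t * e₀) * ((z ^ (t * m))⁻¹ * (z ^ s) ^ (q - 1)) =
      z ^ (1 - (s : ℤ) - (P.natDegree : ℤ)) * (z ^ (t * α + s)) ^ n := by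
    simp only [← pow_mul]
    simp only [← zpow_natCast z]
    rw [← zpow_neg, ← zpow_add₀ hz, ← zpow_add₀ hz, ← zpow_add₀ hz]
    congr 1
    have hbz : (q : ℤ) * s = t * m + 1 := by exact_mod_cast h.bezout
    have hq1 : ((q - 1 : ℕ) : ℤ) = q - 1 := by
      have := h.q_pos
      push_cast [this]; ring
    rw [← he₀, hn]
    push_cast
    rw [hq1]
    linear_combination (1 - (P.natDegree : ℤ)) * hbz
  rw [mul_pow]
  linear_combination (b.coeff 0 ^ n * eval z (derivative P) * q) * hexp

end Step

end RationalPuiseux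

end

noncomputable section

open Polynomial PowerSeries

namespace RationalPuiseux

/-! ### An annihilating polynomial of the expected degree. -/

section CharpolyBound

variable {K E : Type*} [Field K] [Field E] [Algebra K E]

theorem seriesSubst_seriesSubst {L : Type*} [Field L] (a b : L) {q r : ℕ} (hq : q ≠ 0) (hr : r ≠ 0)
    (f : L⟦X⟧) : seriesSubst a q hq (seriesSubst b r hr f) =
      seriesSubst (b * a ^ r) (q * r) (mul_ne_zero hq hr) f := by
  ext n
  by_cases h1 : q ∣ n
  · obtain ⟨n, rfl⟩ := h1
    rw [coeff_mul_seriesSubst]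
    by_cases h2 : r ∣ n
    · obtain ⟨n, rfl⟩ := h2
      rw [coeff_mul_seriesSubst, ← mul_assoc q, coeff_mul_seriesSubst, mul_pow, pow_mul]
      ring
    · rw [coeff_seriesSubst_of_not_dvd _ _ _ _ h2, coeff_seriesSubst_of_not_dvd _ _ _ _
        (fun h => h2 (Nat.dvd_of_mul_dvd_mul_left (Nat.pos_of_ne_zero hq) h)), mul_zero]
  · rw [coeff_seriesSubst_of_not_dvd _ _ _ _ h1, coeff_seriesSubst_of_not_dvd _ _ _ _
      (fun h => h1 ((Dvd.intro _ rfl).trans h))]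

/-- Power series over a finite extension `k` of `K` are spanned by `e [k : K]` elements over
`K⟦X⟧` acting through `x ↦ μ x ^ e`. -/
theorem exists_span_seriesSubst (k : IntermediateField K E) [FiniteDimensional K k] {μ : E}
    (hμ : μ ∈ k) (hμ0 : μ ≠ 0) {e : ℕ} (he : e ≠ 0) (g : E⟦X⟧)
    (hg : ∀ n, PowerSeries.coeff n g ∈ k) :
    ∃ c : Fin (Module.finrank K k) × Fin e → K⟦X⟧,
      g = ∑ a, seriesSubst μ e he (PowerSeries.map (algebraMap K E) (c a)) *
        (PowerSeries.C (Module.finBasis K k a.1 : E) * PowerSeries.X ^ (a.2 : ℕ)) := by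
  set β := Module.finBasis K k
  have hmem : ∀ n j : ℕ, PowerSeries.coeff (e * n + j) g / μ ^ n ∈ k :=
    fun n j => div_mem (hg _) (pow_mem hμ n)
  -- Split exponents as `e n + j` with `j < e`, undo the factor `μ ^ n` produced by `x ↦ μ x ^ e`,
  -- and take coordinates in a `K`-basis of `k`.
  refine ⟨fun a => PowerSeries.mk fun n => β.repr ⟨_, hmem n a.2⟩ a.1, ?_⟩
  ext N
  rw [map_sum, Fintype.sum_prod_type]
  have hepos := Nat.pos_of_ne_zero he
  set j₀ : Fin e := ⟨N % e, Nat.mod_lt _ hepos⟩ with hj₀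
  set n := N / e with hn
  have hN : e * n + j₀ = N := Nat.div_add_mod N e
  have hterm : ∀ (i : Fin (Module.finrank K k)) (j : Fin e),
      PowerSeries.coeff N (seriesSubst μ e he (PowerSeries.map (algebraMap K E)
        (PowerSeries.mk fun n => β.repr ⟨_, hmem n j⟩ i)) *
        (PowerSeries.C (β i : E) * PowerSeries.X ^ (j : ℕ))) =
      if j = j₀ then μ ^ n * (algebraMap K E (β.repr ⟨_, hmem n j₀⟩ i) * β i) else 0 := by
    intro i j
    rw [mul_left_comm, ← mul_assoc, PowerSeries.coeff_mul_X_pow', PowerSeries.coeff_C_mul]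
    split_ifs with h1 h2 h2
    · subst h2
      have : N - (j₀ : ℕ) = e * n := by omega
      rw [this, coeff_mul_seriesSubst, PowerSeries.coeff_map, PowerSeries.coeff_mk]
      ring
    · rw [coeff_seriesSubst_of_not_dvd, mul_zero]
      intro hdvd
      refine h2 (Fin.ext ?_)
      have h3 : (j : ℕ) ≡ N [MOD e] := (Nat.modEq_iff_dvd' h1).mpr hdvd
      have h4 := h3
      rw [Nat.ModEq, Nat.mod_eq_of_lt j.2] at h4
      rw [hj₀, h4]
    · subst h2
      omega
    · rfl
  simp only [hterm]
  simp only [Finset.sum_ite_eq', Finset.mem_univ, if_true, ← Finset.mul_sum]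
  have hrep := congr_arg (algebraMap k E) (β.sum_repr ⟨_, hmem n j₀⟩)
  simp only [map_sum, Algebra.smul_def, map_mul, ← IsScalarTower.algebraMap_apply] at hrep
  have hrep' : ∑ i, algebraMap K E (β.repr ⟨_, hmem n j₀⟩ i) * (β i : E) =
    PowerSeries.coeff (e * n + j₀) g / μ ^ n := hrep
  rw [hrep', hN, mul_div_cancel₀ _ (pow_ne_zero _ hμ0)]

/-- Determinant trick: multiplication by `S` maps the spanning family `β_i x ^ j` into its span over
`K[[x]]`, so `S` is an eigenvalue of a matrix of size `[k : K] e`, with this family as eigenvector.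
-/
theorem exists_monic_eval₂_eq_zero (k : IntermediateField K E) [FiniteDimensional K k] {μ : E}
    (hμ : μ ∈ k) (hμ0 : μ ≠ 0) {e : ℕ} (he : e ≠ 0) (S : E⟦X⟧)
    (hS : ∀ n, PowerSeries.coeff n S ∈ k) :
    ∃ p : K⟦X⟧[X], p.Monic ∧ p.natDegree = Module.finrank K k * e ∧
      p.eval₂ ((seriesSubst μ e he).comp (PowerSeries.map (algebraMap K E))) S = 0 := by
  classical
  set ψ := (seriesSubst μ e he).comp (PowerSeries.map (algebraMap K E)) with hψ
  set b : Fin (Module.finrank K k) × Fin e → E⟦X⟧ := fun a =>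
    PowerSeries.C (Module.finBasis K k a.1 : E) * PowerSeries.X ^ (a.2 : ℕ) with hb
  have hcoef : ∀ a n, PowerSeries.coeff n (S * b a) ∈ k := by
    intro a n
    rw [hb]
    dsimp only
    rw [mul_left_comm, PowerSeries.coeff_C_mul, PowerSeries.coeff_mul_X_pow']
    refine mul_mem (SetLike.coe_mem _) ?_
    split_ifs
    · exact hS _
    · exact zero_mem _
  choose A hA using fun a => exists_span_seriesSubst k hμ hμ0 he (S * b a) (hcoef a)
  let M : Matrix (Fin (Module.finrank K k) × Fin e) (Fin (Module.finrank K k) × Fin e) K⟦X⟧ :=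
    Matrix.of A
  refine ⟨M.charpoly, M.charpoly_monic, ?_, ?_⟩
  · rw [Matrix.charpoly_natDegree_eq_dim, Fintype.card_prod, Fintype.card_fin, Fintype.card_fin]
  · rw [← eval_map, ← Matrix.charpoly_map, Matrix.eval_charpoly]
    refine Matrix.exists_mulVec_eq_zero_iff.mp ⟨b, ?_, ?_⟩
    · intro h0
      have hpos : 0 < Module.finrank K k := Module.finrank_pos
      have := congr_fun h0 (⟨0, hpos⟩, ⟨0, Nat.pos_of_ne_zero he⟩)
      simp only [hb, pow_zero, mul_one, Pi.zero_apply] at this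
      have h2 : ((Module.finBasis K k ⟨0, hpos⟩ : k) : E) = 0 := by
        simpa using this
      exact (Module.finBasis K k).ne_zero ⟨0, hpos⟩ (by exact_mod_cast h2)
    · rw [Matrix.sub_mulVec, sub_eq_zero]
      ext1 a
      rw [Matrix.scalar_apply, Matrix.mulVec_diagonal, hA a]
      rfl

end CharpolyBound

/-! ### Series and polynomials with coefficients in a subfield; Weierstrass polynomials. -/

section CoefficientField

variable {K E : Type*} [Field K] [Field E] [Algebra K E]

/-- Power series with coefficients in `k`. -/
def seriesOver (k : IntermediateField K E) : Subring E⟦X⟧ :=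
  (PowerSeries.map (algebraMap k E)).range

/-- Polynomials over power series with coefficients in `k`. -/
def polyOver (k : IntermediateField K E) : Subring E⟦X⟧[X] :=
  (Polynomial.mapRingHom (PowerSeries.map (algebraMap k E))).range

theorem mem_seriesOver {k : IntermediateField K E} {f : E⟦X⟧} :
    f ∈ seriesOver k ↔ ∀ n, PowerSeries.coeff n f ∈ k := by
  constructor
  · rintro ⟨g, rfl⟩ n
    rw [PowerSeries.coeff_map]
    exact SetLike.coe_mem _
  · intro h
    exact ⟨PowerSeries.mk fun n => ⟨_, h n⟩, by ext n; simp⟩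

theorem C_mem_polyOver {k : IntermediateField K E} {f : E⟦X⟧} (hf : f ∈ seriesOver k) :
    Polynomial.C f ∈ polyOver k := by
  obtain ⟨g, rfl⟩ := hf
  exact ⟨Polynomial.C g, by simp⟩

theorem X_mem_polyOver (k : IntermediateField K E) : (Polynomial.X : E⟦X⟧[X]) ∈ polyOver k :=
  ⟨Polynomial.X, by simp⟩

theorem coeff_mem_seriesOver {k : IntermediateField K E} {A : E⟦X⟧[X]} (hA : A ∈ polyOver k)
    (i : ℕ) : A.coeff i ∈ seriesOver k := by
  obtain ⟨B, rfl⟩ := hA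
  exact ⟨B.coeff i, by simp⟩

theorem mem_polyOver_of_coeff {k : IntermediateField K E} {A : E⟦X⟧[X]}
    (hA : ∀ i, A.coeff i ∈ seriesOver k) : A ∈ polyOver k := by
  rw [A.as_sum_range_C_mul_X_pow]
  exact sum_mem fun i _ => mul_mem (C_mem_polyOver (hA i)) (pow_mem (X_mem_polyOver k) i)

theorem seriesOver_mono {k k' : IntermediateField K E} (h : k ≤ k') :
    seriesOver k ≤ seriesOver k' :=
  fun _ hf => mem_seriesOver.mpr fun n => h (mem_seriesOver.mp hf n)

theorem seriesSubst_mem {k : IntermediateField K E} {a : E} (ha : a ∈ k) {q : ℕ} (hq : q ≠ 0)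
    {f : E⟦X⟧} (hf : f ∈ seriesOver k) : seriesSubst a q hq f ∈ seriesOver k := by
  rw [mem_seriesOver] at *
  intro n
  by_cases h : q ∣ n
  · obtain ⟨n, rfl⟩ := h
    rw [coeff_mul_seriesSubst]
    exact mul_mem (pow_mem ha n) (hf n)
  · rw [coeff_seriesSubst_of_not_dvd _ _ _ _ h]
    exact zero_mem _

theorem substHom_mem {k : IntermediateField K E} {a : E} (ha : a ∈ k) {q : ℕ} (hq : q ≠ 0)
    {Y A : E⟦X⟧[X]} (hY : Y ∈ polyOver k) (hA : A ∈ polyOver k) :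
    substHom a q hq Y A ∈ polyOver k := by
  rw [substHom_apply, eval₂_eq_sum_range]
  exact sum_mem fun i _ => mul_mem
    (C_mem_polyOver (seriesSubst_mem ha hq (coeff_mem_seriesOver hA i))) (pow_mem hY i)

theorem C_mem_seriesOver {k : IntermediateField K E} {a : E} (ha : a ∈ k) :
    PowerSeries.C a ∈ seriesOver k :=
  ⟨PowerSeries.C ⟨a, ha⟩, by simp⟩

theorem X_mem_seriesOver (k : IntermediateField K E) : (PowerSeries.X : E⟦X⟧) ∈ seriesOver k :=
  ⟨PowerSeries.X, by simp⟩

end CoefficientField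

section Weierstrass

variable {L : Type*} [Field L]

theorem isWeierstrass_iff {F : L⟦X⟧[X]} : IsWeierstrass F ↔
    F.Monic ∧ F.map (PowerSeries.constantCoeff (R := L)) = Polynomial.X ^ F.natDegree := by
  refine and_congr_right fun hF => ⟨fun h => ?_, fun h i hi => ?_⟩
  · ext i
    rw [Polynomial.coeff_map, Polynomial.coeff_X_pow]
    rcases lt_trichotomy i F.natDegree with hi | rfl | hi
    · rw [h i hi, if_neg hi.ne]
    · rw [hF.coeff_natDegree, if_pos rfl, map_one]
    · rw [coeff_eq_zero_of_natDegree_lt hi, if_neg hi.ne', map_zero]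
  · rw [← Polynomial.coeff_map, h, Polynomial.coeff_X_pow, if_neg hi.ne]

theorem natDegree_comp_X_add_C_series (F : L⟦X⟧[X]) (c : L⟦X⟧) :
    (F.comp (Polynomial.X + Polynomial.C c)).natDegree = F.natDegree := by
  rw [natDegree_comp, natDegree_X_add_C, mul_one]

theorem IsWeierstrass.comp {F : L⟦X⟧[X]} (hF : IsWeierstrass F) {c : L⟦X⟧}
    (hc : PowerSeries.constantCoeff c = 0) :
    IsWeierstrass (F.comp (Polynomial.X + Polynomial.C c)) := by
  rw [isWeierstrass_iff] at *
  refine ⟨hF.1.comp_X_add_C c, ?_⟩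
  rw [Polynomial.map_comp, hF.2, natDegree_comp_X_add_C_series]
  simp [hc]

theorem IsWeierstrass.map {K : Type*} [Field K] {F : K⟦X⟧[X]} (hF : IsWeierstrass F)
    (ι : K →+* L) : IsWeierstrass (F.map (PowerSeries.map ι)) := by
  refine ⟨hF.1.map _, fun i hi => ?_⟩
  rw [hF.1.natDegree_map] at hi
  rw [Polynomial.coeff_map, ← PowerSeries.coeff_zero_eq_constantCoeff_apply,
    PowerSeries.coeff_map, PowerSeries.coeff_zero_eq_constantCoeff_apply, hF.2 i hi, map_zero]

end Weierstrass

end RationalPuiseux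

end

noncomputable section

open Polynomial PowerSeries

namespace RationalPuiseux

variable {K E : Type*} [Field K] [Field E] [Algebra K E]

namespace Data

/-! ### Degrees of the residue fields and separability of the residual polynomials. -/

section ResidueField

variable (D : Data E)

theorem residueField_mono {j k : ℕ} (h : j ≤ k) : D.residueField K j ≤ D.residueField K k := by
  refine IntermediateField.adjoin.mono _ _ _ ?_
  rintro w ⟨i, h1, h2, h3⟩
  exact ⟨i, h1, h2.trans h, h3⟩

theorem z_mem_residueField {i k : ℕ} (hi : 1 ≤ i) (hik : i ≤ k) : D.z i ∈ D.residueField K k :=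
  IntermediateField.subset_adjoin _ _ ⟨i, hi, hik, rfl⟩

theorem finrank_residueField_zero : Module.finrank K (D.residueField K 0) = 1 := by
  have : D.residueField K 0 = ⊥ := by
    rw [residueField, IntermediateField.adjoin_eq_bot_iff]
    rintro w ⟨i, h1, h2, -⟩
    omega
  rw [this, IntermediateField.finrank_bot]

theorem finrank_residueField_succ (k : ℕ) (hz : IsIntegral (D.residueField K k) (D.z (k + 1))) :
    Module.finrank K (D.residueField K (k + 1)) =
      Module.finrank K (D.residueField K k) *
        (minpoly (D.residueField K k) (D.z (k + 1))).natDegree := by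
  have hset : {w | ∃ i, 1 ≤ i ∧ i ≤ k + 1 ∧ w = D.z i} =
      {w | ∃ i, 1 ≤ i ∧ i ≤ k ∧ w = D.z i} ∪ {D.z (k + 1)} := by
    ext w
    constructor
    · rintro ⟨i, h1, h2, h3⟩
      rcases Nat.lt_or_ge k i with h | h
      · obtain rfl : i = k + 1 := by omega
        exact Or.inr h3
      · exact Or.inl ⟨i, h1, h, h3⟩
    · rintro (⟨i, h1, h2, h3⟩ | h)
      · exact ⟨i, h1, by omega, h3⟩
      · exact ⟨k + 1, by omega, le_rfl, h⟩
  have h1 : D.residueField K (k + 1) =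
      (IntermediateField.adjoin (D.residueField K k) {D.z (k + 1)}).restrictScalars K := by
    rw [residueField, hset]
    exact (IntermediateField.adjoin_adjoin_left K _ _).symm
  rw [← IntermediateField.adjoin.finrank hz, Module.finrank_mul_finrank, h1]
  rfl

end ResidueField

theorem derivative_ne_zero_of_natDegree_ne_zero {L : Type*} [Field L] {P : L[X]} (hP : P.Monic)
    (h : (P.natDegree : L) ≠ 0) : derivative P ≠ 0 := by
  intro h0
  have h1 : P.natDegree ≠ 0 := by
    intro h1
    rw [h1, Nat.cast_zero] at h
    exact h rfl
  have hc := congr_arg (fun p => p.coeff (P.natDegree - 1)) h0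
  simp only [Polynomial.coeff_derivative, Polynomial.coeff_zero] at hc
  rw [Nat.sub_add_cancel (Nat.pos_of_ne_zero h1), hP.coeff_natDegree, one_mul, ← Nat.cast_succ,
    Nat.succ_eq_add_one, Nat.sub_add_cancel (Nat.pos_of_ne_zero h1)] at hc
  exact h hc

/-- Otherwise `P` divides `P'`, so `P' = 0` by degree, although its top coefficient is `deg P ≠ 0`.
-/
theorem eval_derivative_ne_zero {k : IntermediateField K E} {P : E[X]}
    (hP : P.Monic) (hirr : ∃ p : k[X], Irreducible p ∧ p.map (algebraMap k E) = P) {z : E}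
    (hz : P.eval z = 0) (hchar : (P.natDegree : E) ≠ 0) : (derivative P).eval z ≠ 0 := by
  intro h0
  obtain ⟨p, hp, hpP⟩ := hirr
  have hd : (derivative p).map (algebraMap k E) = derivative P := by rw [← hpP, derivative_map]
  have hdvd := dvd_of_eval_eq_zero hp hpP hP hz (Q := derivative p) (by rwa [hd])
  have hpz : derivative p = 0 := by
    refine eq_zero_of_dvd_of_natDegree_lt hdvd (natDegree_derivative_lt ?_)
    intro h1
    rw [← hpP, natDegree_map, h1, Nat.cast_zero] at hchar
    exact hchar rfl
  refine derivative_ne_zero_of_natDegree_ne_zero hP hchar ?_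
  rw [← hd, hpz, Polynomial.map_zero]

/-! ### Invariants of a run of the algorithm. -/

namespace IsRun

variable {D : Data E} {F : K⟦X⟧[X]}

theorem constantCoeff_c_zero (hD : D.IsRun F) (hW : IsWeierstrass F) (hd : 0 < F.natDegree) :
    PowerSeries.constantCoeff (D.c 0) = 0 := by
  have := (hW.map (algebraMap K E)).2 (F.natDegree - 1) (by rw [hW.1.natDegree_map]; omega)
  rw [Polynomial.coeff_map] at this
  rw [hD.c_zero, hD.N_zero, map_neg, ← PowerSeries.coeff_zero_eq_constantCoeff_apply,
    PowerSeries.coeff_smul, PowerSeries.coeff_zero_eq_constantCoeff_apply, this, smul_zero, neg_zero]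

theorem constantCoeff_c_succ (hD : D.IsRun F) {k : ℕ} (hk : k < D.g) (hN : 0 < D.N (k + 1)) :
    PowerSeries.constantCoeff (D.c (k + 1)) = 0 := by
  have := (hD.G_weierstrass k hk).2 (D.N (k + 1) - 1) (by rw [hD.G_natDegree k hk]; omega)
  rw [hD.c_succ k hk, map_neg, ← PowerSeries.coeff_zero_eq_constantCoeff_apply,
    PowerSeries.coeff_smul, PowerSeries.coeff_zero_eq_constantCoeff_apply, this, smul_zero, neg_zero]

theorem c_mem (hD : D.IsRun F) : ∀ k ≤ D.g, D.c k ∈ seriesOver (D.residueField K k)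
  | 0, _ => by
    rw [mem_seriesOver, hD.c_zero]
    intro n
    rw [map_neg, PowerSeries.coeff_smul, PowerSeries.coeff_map]
    exact neg_mem (mul_mem (inv_mem (natCast_mem _ _)) (IntermediateField.algebraMap_mem _ _))
  | k + 1, hk => by
    rw [mem_seriesOver, hD.c_succ k hk]
    intro n
    rw [map_neg, PowerSeries.coeff_smul]
    exact neg_mem (mul_mem (inv_mem (natCast_mem _ _)) (hD.G_coeff k hk _ _))

theorem sigma_apply_mem (hD : D.IsRun F) {k : ℕ} (hk : k < D.g) {A : E⟦X⟧[X]}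
    (hA : A ∈ polyOver (D.residueField K k)) :
    D.sigma (k + 1) A ∈ polyOver (D.residueField K (k + 1)) := by
  have hz : D.z (k + 1) ∈ D.residueField K (k + 1) := D.z_mem_residueField (by omega) le_rfl
  refine substHom_mem (pow_mem hz _) _ (mul_mem (C_mem_polyOver (pow_mem (X_mem_seriesOver _) _))
    (add_mem (add_mem (X_mem_polyOver _) (C_mem_polyOver (C_mem_seriesOver (pow_mem hz _))))
      (C_mem_polyOver (hD.c_mem (k + 1) hk)))) (mem_polyOver_of_coeff fun i => ?_)
  exact seriesOver_mono (D.residueField_mono (Nat.le_succ k)) (coeff_mem_seriesOver hA i)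

theorem piPull_mem (hD : D.IsRun F) : ∀ k ≤ D.g, ∀ A : K⟦X⟧[X],
    D.piPull K k A ∈ polyOver (D.residueField K k)
  | 0, _, A => by
    have hA : A.map (PowerSeries.map (algebraMap K E)) ∈ polyOver (D.residueField K 0) := by
      refine mem_polyOver_of_coeff fun i => mem_seriesOver.mpr fun n => ?_
      rw [Polynomial.coeff_map, PowerSeries.coeff_map]
      exact IntermediateField.algebraMap_mem _ _
    change (A.map (PowerSeries.map (algebraMap K E))).comp _ ∈ _
    rw [Polynomial.comp, eval₂_eq_sum_range]
    exact sum_mem fun i _ => mul_mem (C_mem_polyOver (coeff_mem_seriesOver hA i))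
      (pow_mem (add_mem (X_mem_polyOver _) (C_mem_polyOver (hD.c_mem 0 (Nat.zero_le _)))) _)
  | k + 1, hk, A => hD.sigma_apply_mem hk (piPull_mem hD k (by omega) A)

/-- The polynomials `H_k` are Weierstrass without multiple roots, of degree dividing `deg F`. -/
theorem H_spec (hD : D.IsRun F) (hW : IsWeierstrass F) (hd : 0 < F.natDegree) (hsq : Squarefree F)
    (hchar : ∀ n : ℕ, 0 < n → n ≤ F.natDegree → (n : K) ≠ 0) : ∀ k ≤ D.g,
    IsWeierstrass (D.H k) ∧ (D.H k).natDegree = D.N k ∧ 0 < D.N k ∧ D.N k ∣ F.natDegree ∧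
      NoDoubleRoot (D.H k) := by
  intro k
  induction k with
  | zero =>
    intro _
    have hc := hD.constantCoeff_c_zero hW hd
    rw [hD.H_zero]
    refine ⟨(hW.map _).comp hc, ?_, ?_, ?_, ?_⟩
    · rw [natDegree_comp_X_add_C_series, hW.1.natDegree_map, hD.N_zero]
    · rwa [hD.N_zero]
    · rw [hD.N_zero]
    · refine NoDoubleRoot.of_comp hc fun τ hτ _ ρ _ h0 => ?_
      rw [derivative_map, eval₂_map] at *
      refine not_double_root_of_squarefree (τ.comp (PowerSeries.map (algebraMap K E)))
        (hτ.comp (PowerSeries.map_injective _ (algebraMap K E).injective)) hW.1 hsq ?_ ρ h0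
      intro n hn hn' h
      have := congr_arg (PowerSeries.constantCoeff (R := K)) h
      rw [map_natCast, map_zero] at this
      exact hchar n hn hn' this
  | succ k ih =>
    intro hk
    obtain ⟨hHW, hHd, hN, hNd, hnd⟩ := ih (by omega)
    have hne : D.H k ≠ Polynomial.X ^ (D.H k).natDegree :=
      hnd.ne_X_pow (by rw [hHd]; exact hD.one_lt k hk)
    have hedge := hD.edge k hk
    have hm := hedge.slope_pos hHW hne
    have hdeg := hedge.natDegree_eq hHW
    rw [hHd] at hdeg
    have hz : D.z (k + 1) ≠ 0 := by
      intro hz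
      have := hD.root k hk
      rw [hz] at this
      exact hedge.eval_zero_ne_zero hHW hne this
    have hN' : 0 < D.N (k + 1) := Nat.pos_of_ne_zero fun h => by
      rw [h, mul_zero] at hdeg
      omega
    have hc := hD.constantCoeff_c_succ hk hN'
    rw [hD.H_succ k hk]
    refine ⟨(hD.G_weierstrass k hk).comp hc, ?_, hN', ?_, ?_⟩
    · rw [natDegree_comp_X_add_C_series, hD.G_natDegree k hk]
    · exact Dvd.dvd.trans ⟨_, by rw [hdeg, mul_comm]⟩ hNd
    · refine NoDoubleRoot.of_comp hc ?_
      obtain ⟨V, -, hV⟩ := hD.G_eq k hk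
      -- The power of `x` and the factor `V` are absorbed together into `W`.
      refine hnd.of_substHom (D.q_ne_zero (k + 1)) (pow_ne_zero (D.t (k + 1)) hz) hm
        (b := D.z (k + 1) ^ D.s (k + 1)) (G := D.G (k + 1)) (W := PowerSeries.C
          ((PowerSeries.X : E⟦X⟧) ^ (D.q (k + 1) * D.m (k + 1) * D.ell (k + 1) * D.N (k + 1))) * V)
        ?_
      rw [mul_left_comm, ← mul_assoc]
      exact hV

/-- Every step of a run is a substitution of the expected shape. -/
theorem isStep (hD : D.IsRun F) (hW : IsWeierstrass F) (hd : 0 < F.natDegree) (hsq : Squarefree F)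
    (hchar : ∀ n : ℕ, 0 < n → n ≤ F.natDegree → (n : K) ≠ 0) {k : ℕ} (hk : k < D.g) :
    IsStep (D.residueField K k) (D.sigma (k + 1)) (D.q (k + 1)) (D.m (k + 1)) (D.t (k + 1))
      (D.s (k + 1)) (D.z (k + 1)) (D.P (k + 1)) ∧
      (D.q (k + 1) : E) ≠ 0 ∧ ((D.P (k + 1)).natDegree : E) ≠ 0 := by
  obtain ⟨hHW, hHd, hN, hNd, hnd⟩ := hD.H_spec hW hd hsq hchar k hk.le
  have hN' := (hD.H_spec hW hd hsq hchar (k + 1) hk).2.2.1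
  have hne : D.H k ≠ Polynomial.X ^ (D.H k).natDegree :=
    hnd.ne_X_pow (by rw [hHd]; exact hD.one_lt k hk)
  have hedge := hD.edge k hk
  have hm := hedge.slope_pos hHW hne
  have hdeg := hedge.natDegree_eq hHW
  rw [hHd] at hdeg
  -- Divisors of `N_k` divide `deg F`, so they are nonzero in `E`; this is applied to `q` and to
  -- `deg P`.
  have hcE : ∀ n : ℕ, n ∣ D.N k → (n : E) ≠ 0 := by
    intro n hn h
    have hnF := hn.trans hNd
    refine hchar n (Nat.pos_of_dvd_of_pos hnF hd) (Nat.le_of_dvd hd hnF) ?_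
    rw [← map_natCast (algebraMap K E)] at h
    exact (map_eq_zero (algebraMap K E)).mp h
  have hc := hD.constantCoeff_c_succ hk hN'
  refine ⟨⟨hedge.q_pos, hm, hD.bezout k hk, ?_, hedge.monic, hedge.irreducible, hD.root k hk,
    fun A v b h => h.substHom _ (D.q_ne_zero (k + 1)) hm _, ?_⟩, hcE _ ?_, hcE _ ?_⟩
  · intro hz
    have := hD.root k hk
    rw [hz] at this
    exact hedge.eval_zero_ne_zero hHW hne this
  · refine ⟨_, substHom_X _ _ _ _, ?_⟩
    simp [hc]
  · rw [hdeg, mul_assoc]; exact Dvd.intro _ rfl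
  · rw [hdeg, mul_comm (D.q _), mul_assoc]; exact Dvd.intro _ rfl

end IsRun

/-! ### Degree and pull-back of the minimal polynomials. -/

/-- The degree `∏_{i ≤ k} q_i ℓ_i` of the `k`-th minimal polynomial. -/
def phiDegree (D : Data E) : ℕ → ℕ
  | 0 => 1
  | k + 1 => D.q (k + 1) * (D.P (k + 1)).natDegree * phiDegree D k

/-- The annihilator `p` bounds the degree above. A nonzero polynomial of lower degree pulls back to
one with nonzero coefficient of `y ^ 0`, so it cannot vanish on the parametrisation. -/
theorem minimalPolynomial_spec (D : Data E) {k d : ℕ} (hd : IsUnitBelow (D.piPull K k) d)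
    {p : K⟦X⟧[X]} (hp : p.Monic) (hpd : p.natDegree = d) (hp0 : D.evalParam K k p = 0) :
    (D.minimalPolynomial K k).Monic ∧ (D.minimalPolynomial K k).natDegree = d ∧
      (D.piPull K k (D.minimalPolynomial K k)).eval 0 = 0 := by
  let alg : Algebra K⟦X⟧ E⟦X⟧ := ((D.evalParam K k).comp Polynomial.C).toAlgebra
  have haeval : ∀ A : K⟦X⟧[X], aeval (D.evalParam K k Polynomial.X) A = D.evalParam K k A := by
    intro A
    have : (aeval (R := K⟦X⟧) (D.evalParam K k Polynomial.X) : K⟦X⟧[X] →ₐ[K⟦X⟧] E⟦X⟧).toRingHom =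
        D.evalParam K k := by
      refine Polynomial.ringHom_ext (fun f => ?_) ?_
      · simp [RingHom.algebraMap_toAlgebra]
      · simp
    exact DFunLike.congr_fun this A
  have hint : IsIntegral K⟦X⟧ (D.evalParam K k Polynomial.X) := ⟨p, hp, (haeval p).trans hp0⟩
  have hmon : (D.minimalPolynomial K k).Monic := minpoly.monic hint
  have h0 : D.evalParam K k (D.minimalPolynomial K k) = 0 :=
    (haeval _).symm.trans (minpoly.aeval _ _)
  refine ⟨hmon, le_antisymm ?_ ?_, h0⟩
  · rw [← hpd]
    exact natDegree_le_natDegree (minpoly.min K⟦X⟧ _ hp ((haeval p).trans hp0))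
  · by_contra! hlt
    obtain ⟨v, b, hvb, hb⟩ := hd _ hmon.ne_zero
      (by rw [degree_eq_natDegree hmon.ne_zero]; exact_mod_cast hlt)
    have hc := hvb.coeff 0
    have h0' : (D.piPull K k (D.minimalPolynomial K k)).coeff 0 = 0 := by
      rw [Polynomial.coeff_zero_eq_eval_zero]; exact h0
    rw [h0', map_zero] at hc
    exact hb hc.symm

end Data

end RationalPuiseux

end

noncomputable section

open Polynomial PowerSeries

namespace RationalPuiseux

variable {K E : Type*} [Field K] [Field E] [Algebra K E]

theorem Data.piPull_zero_eq_X (D : Data E) {φ : K⟦X⟧[X]} (hmon : φ.Monic)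
    (hdeg : φ.natDegree = 1) (hroot : (D.piPull K 0 φ).eval 0 = 0) :
    D.piPull K 0 φ = Polynomial.X := by
  have hpull : D.piPull K 0 φ = (φ.map (PowerSeries.map (algebraMap K E))).comp
    (Polynomial.X + Polynomial.C (D.c 0)) := rfl
  have hmon' : (D.piPull K 0 φ).Monic := by
    rw [hpull]; exact (hmon.map _).comp_X_add_C _
  have hdeg' : (D.piPull K 0 φ).natDegree = 1 := by
    rw [hpull, natDegree_comp_X_add_C_series, hmon.natDegree_map, hdeg]
  rw [hmon'.eq_X_add_C hdeg', Polynomial.coeff_zero_eq_eval_zero, hroot, Polynomial.C_0, add_zero]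

namespace Data.IsRun

variable {D : Data E} {F : K⟦X⟧[X]}

/-- The first component `μ_k x ^ e_k` of the truncated parametrisation. -/
theorem exists_piPull_C (hD : D.IsRun F) (hW : IsWeierstrass F) (hd : 0 < F.natDegree)
    (hsq : Squarefree F) (hchar : ∀ n : ℕ, 0 < n → n ≤ F.natDegree → (n : K) ≠ 0) :
    ∀ k ≤ D.g, ∃ (μ : E) (e : ℕ) (he : e ≠ 0), μ ∈ D.residueField K k ∧ μ ≠ 0 ∧
      0 < Module.finrank K (D.residueField K k) ∧
      Module.finrank K (D.residueField K k) * e = D.phiDegree k ∧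
      ∀ f, D.piPull K k (Polynomial.C f) =
        Polynomial.C (seriesSubst μ e he (PowerSeries.map (algebraMap K E) f)) := by
  intro k
  induction k with
  | zero =>
    intro _
    refine ⟨1, 1, one_ne_zero, one_mem _, one_ne_zero, ?_, ?_, fun f => ?_⟩
    · rw [D.finrank_residueField_zero]; exact one_pos
    · rw [D.finrank_residueField_zero]; rfl
    · have h1 : ∀ g : E⟦X⟧, seriesSubst 1 1 one_ne_zero g = g := fun g => by
        ext n
        have := coeff_mul_seriesSubst 1 1 one_ne_zero g n
        simpa using this
      rw [h1]
      simp [piPull]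
  | succ k ih =>
    intro hk
    obtain ⟨μ, e, he, hμ, hμ0, hpos, hdeg, hC⟩ := ih (by omega)
    obtain ⟨hstep, -, -⟩ := hD.isStep hW hd hsq hchar hk
    obtain ⟨p, hp, hpP⟩ := hstep.irreducible
    have hpm : p.Monic := monic_of_injective (algebraMap _ E).injective (hpP ▸ hstep.monic)
    have hroot : aeval (D.z (k + 1)) p = 0 := by
      have := hstep.root
      rwa [← hpP, eval_map] at this
    have hmin := minpoly.eq_of_irreducible_of_monic hp hroot hpm
    have hfin := D.finrank_residueField_succ (K := K) k ⟨p, hpm, hroot⟩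
    rw [← hmin, ← natDegree_map (algebraMap (D.residueField K k) E), hpP] at hfin
    -- The composite of `x ↦ μ x ^ e` with `x ↦ z^t x^q`.
    refine ⟨μ * (D.z (k + 1) ^ D.t (k + 1)) ^ e, D.q (k + 1) * e,
      mul_ne_zero (D.q_ne_zero _) he, ?_, ?_, ?_, ?_, fun f => ?_⟩
    · exact mul_mem (D.residueField_mono (Nat.le_succ k) hμ)
        (pow_mem (pow_mem (D.z_mem_residueField (by omega) le_rfl) _) _)
    · exact mul_ne_zero hμ0 (pow_ne_zero _ (pow_ne_zero _ hstep.z_ne_zero))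
    · rw [hfin]
      refine Nat.mul_pos hpos ?_
      rw [← hpP, natDegree_map]
      exact hp.natDegree_pos
    · rw [hfin, phiDegree, ← hdeg]
      ring
    · change D.sigma (k + 1) (D.piPull K k (Polynomial.C f)) = _
      rw [hC, ← seriesSubst_seriesSubst _ _ (D.q_ne_zero _) he]
      exact substHom_C _ _ _ _ _

theorem evalParam_X_mem (hD : D.IsRun F) {k : ℕ} (hk : k ≤ D.g) :
    D.evalParam K k Polynomial.X ∈ seriesOver (D.residueField K k) := by
  have := coeff_mem_seriesOver (hD.piPull_mem k hk Polynomial.X) 0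
  rwa [Polynomial.coeff_zero_eq_eval_zero] at this

theorem exists_monic_evalParam_eq_zero (hD : D.IsRun F) (hW : IsWeierstrass F)
    (hd : 0 < F.natDegree) (hsq : Squarefree F)
    (hchar : ∀ n : ℕ, 0 < n → n ≤ F.natDegree → (n : K) ≠ 0) {k : ℕ} (hk : k ≤ D.g) :
    ∃ p : K⟦X⟧[X], p.Monic ∧ p.natDegree = D.phiDegree k ∧ D.evalParam K k p = 0 := by
  obtain ⟨μ, e, he, hμ, hμ0, hpos, hdeg, hC⟩ := hD.exists_piPull_C hW hd hsq hchar k hk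
  have : FiniteDimensional K (D.residueField K k) := Module.finite_of_finrank_pos hpos
  obtain ⟨p, hp, hpd, hp0⟩ := exists_monic_eval₂_eq_zero (D.residueField K k) hμ hμ0 he
    (D.evalParam K k Polynomial.X) (mem_seriesOver.mp (hD.evalParam_X_mem hk))
  refine ⟨p, hp, hpd.trans hdeg, ?_⟩
  rw [← hp0]
  have : D.evalParam K k = Polynomial.eval₂RingHom
      ((seriesSubst μ e he).comp (PowerSeries.map (algebraMap K E)))
      (D.evalParam K k Polynomial.X) := by
    refine Polynomial.ringHom_ext (fun f => ?_) (by simp)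
    simp [evalParam, hC]
  conv_lhs => rw [this]
  rfl

/-- The pull-back `π_k^* φ_k` is a monomial times `y` times a unit, and polynomials of lower degree
pull back to monomials times units. -/
theorem phi_spec (hD : D.IsRun F) (hW : IsWeierstrass F) (hd : 0 < F.natDegree)
    (hsq : Squarefree F) (hchar : ∀ n : ℕ, 0 < n → n ≤ F.natDegree → (n : K) ≠ 0) :
    ∀ k ≤ D.g, IsUnitBelow (D.piPull K k) (D.phiDegree k) ∧
      (D.minimalPolynomial K k).Monic ∧ (D.minimalPolynomial K k).natDegree = D.phiDegree k ∧
      (D.piPull K k (D.minimalPolynomial K k)).eval 0 = 0 ∧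
      ∃ (U : E⟦X⟧[X]) (α : ℕ) (b : E[X]),
        D.piPull K k (D.minimalPolynomial K k) = Polynomial.X * U ∧
        HasInitialForm U α b ∧ b.coeff 0 ≠ 0 := by
  intro k
  induction k with
  | zero =>
    intro h0
    have hunit : IsUnitBelow (D.piPull K 0) (D.phiDegree 0) := by
      intro a ha hdeg
      obtain ⟨f, rfl⟩ : ∃ f, a = Polynomial.C f :=
        ⟨_, eq_C_of_natDegree_eq_zero
          (Nat.lt_one_iff.mp ((natDegree_lt_iff_degree_lt ha).mpr hdeg))⟩
      have hf : f ≠ 0 := by rintro rfl; simp at ha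
      -- At rank `0` only nonzero constants in `y` have to be treated: a power of `x` times a unit
      -- series.
      obtain ⟨n, hn⟩ := ENat.ne_top_iff_exists.mp (PowerSeries.order_finite_iff_ne_zero.mpr hf).ne
      obtain ⟨h, hh⟩ := PowerSeries.X_pow_dvd_iff.mpr
        (fun m hm => PowerSeries.coeff_of_lt_order m (by rw [← hn]; exact_mod_cast hm) :
          ∀ m < n, PowerSeries.coeff m f = 0)
      have hh0 : PowerSeries.constantCoeff h ≠ 0 := by
        have := (PowerSeries.order_eq_nat.mp hn.symm).1
        rw [hh, PowerSeries.coeff_X_pow_mul', if_pos le_rfl, Nat.sub_self] at this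
        simpa using this
      refine ⟨n, Polynomial.C (algebraMap K E (PowerSeries.constantCoeff h)),
        ⟨Polynomial.C (PowerSeries.map (algebraMap K E) h), ?_, ?_⟩, ?_⟩
      · simp [piPull, hh]
      · rw [Polynomial.map_C, ← PowerSeries.coeff_zero_eq_constantCoeff_apply,
          PowerSeries.coeff_map, PowerSeries.coeff_zero_eq_constantCoeff_apply]
      · simpa using hh0
    obtain ⟨p, hp, hpd, hp0⟩ := hD.exists_monic_evalParam_eq_zero hW hd hsq hchar h0
    obtain ⟨hmon, hdeg, hroot⟩ := D.minimalPolynomial_spec hunit hp hpd hp0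
    refine ⟨hunit, hmon, hdeg, hroot, 1, 0, 1, ?_, HasInitialForm.one, by simp⟩
    rw [mul_one, D.piPull_zero_eq_X hmon hdeg hroot]
  | succ k ih =>
    intro hk
    obtain ⟨hunit, hmon, hdeg, -, U, α, b, hU, hform, hb⟩ := ih (by omega)
    obtain ⟨hstep, hq0, hl0⟩ := hD.isStep hW hd hsq hchar hk
    have hθ : ∀ A i j, PowerSeries.coeff j ((D.piPull K k A).coeff i) ∈ D.residueField K k :=
      fun A i j => mem_seriesOver.mp (coeff_mem_seriesOver (hD.piPull_mem k (by omega) A) i) j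
    have hunit' : IsUnitBelow (D.piPull K (k + 1)) (D.phiDegree (k + 1)) :=
      hstep.isUnitBelow hθ hunit hmon hdeg hU hform hb
    obtain ⟨p, hp, hpd, hp0⟩ := hD.exists_monic_evalParam_eq_zero hW hd hsq hchar hk
    obtain ⟨hmon', hdeg', hroot'⟩ := D.minimalPolynomial_spec hunit' hp hpd hp0
    obtain ⟨U', b', hU', hform', hb'⟩ :=
      hstep.pullback_monic hθ hunit hmon hdeg hU hform hb hmon' hdeg' hroot'
    refine ⟨hunit', hmon', hdeg', hroot', U', _, b', hU', hform', ?_⟩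
    rw [hb']
    have hz := hstep.z_ne_zero
    exact mul_ne_zero (mul_ne_zero (mul_ne_zero hq0 (zpow_ne_zero _ hz))
      (eval_derivative_ne_zero hstep.monic hstep.irreducible hstep.root hl0))
      (pow_ne_zero _ (mul_ne_zero hb (pow_ne_zero _ hz)))

/-- The lists `V` and `Λ` are read off from initial forms. -/
theorem vv_ll_of_hasInitialForm {k : ℕ} {i : ℤ} {v : ℕ} {b : E[X]}
    (h : HasInitialForm (D.piPull K k (D.phi K i)) v b) (hb : b ≠ 0) :
    D.vv K k i = v ∧ D.ll K k i = b.trailingCoeff :=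
  ⟨h.xVal hb, h.xInitial hb⟩

end Data.IsRun

theorem trailingCoeff_of_coeff_zero_ne_zero {L : Type*} [Field L] {b : L[X]} (hb : b.coeff 0 ≠ 0) :
    b.trailingCoeff = b.coeff 0 := by
  rw [Polynomial.trailingCoeff, natTrailingDegree_eq_zero.mpr (Or.inr hb)]

theorem HasInitialForm.X_mul {L : Type*} [Field L] {U : L⟦X⟧[X]} {v : ℕ} {b : L[X]}
    (h : HasInitialForm U v b) :
    HasInitialForm (Polynomial.X * U) v (Polynomial.X * b) := by
  obtain ⟨B, rfl, rfl⟩ := h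
  exact ⟨Polynomial.X * B, by ring, by simp⟩

theorem trailingCoeff_X_mul {L : Type*} [Field L] {b : L[X]} (hb : b.coeff 0 ≠ 0) :
    (Polynomial.X * b : L[X]).trailingCoeff = b.coeff 0 := by
  rw [trailingCoeff_mul, trailingCoeff_of_coeff_zero_ne_zero hb, ← Polynomial.monomial_one_one_eq_X,
    Polynomial.trailingCoeff, natTrailingDegree_monomial one_ne_zero]
  simp

end RationalPuiseux

end

/-! ### Pull-backs of all `φ_i` at later ranks, and the assembly. -/

noncomputable section

open Polynomial PowerSeries

namespace RationalPuiseux.Data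

variable {K E : Type*} [Field K] [Field E] [Algebra K E] {D : Data E} {F : K⟦X⟧[X]}

theorem phi_natCast (D : Data E) (k : ℕ) : D.phi K (k : ℤ) = D.minimalPolynomial K k := by
  rw [phi, if_neg (by omega), Int.toNat_natCast]

theorem phi_neg_one (D : Data E) : D.phi K (-1) = Polynomial.C PowerSeries.X := by
  rw [phi, if_pos (by norm_num)]

/-- The pull-back `π_0^* x = x`. -/
theorem hasInitialForm_phi_neg_one (D : Data E) :
    HasInitialForm (D.piPull K 0 (D.phi K (-1))) 1 1 :=
  ⟨1, by simp [phi_neg_one, piPull], by simp⟩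

/-- `φ_i` pulls back to a monomial times a unit at every later rank. -/
theorem IsRun.exists_hasInitialForm_phi (hD : D.IsRun F) (hW : IsWeierstrass F)
    (hd : 0 < F.natDegree) (hsq : Squarefree F)
    (hchar : ∀ n : ℕ, 0 < n → n ≤ F.natDegree → (n : K) ≠ 0) :
    ∀ k ≤ D.g, ∀ i : ℤ, -1 ≤ i → i < k →
      ∃ v c, HasInitialForm (D.piPull K k (D.phi K i)) v c ∧ c.coeff 0 ≠ 0 := by
  intro k
  induction k with
  | zero =>
    intro _ i h1 h2
    obtain rfl : i = -1 := by push_cast at h2; omega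
    exact ⟨1, 1, D.hasInitialForm_phi_neg_one, by simp⟩
  | succ k ih =>
    intro hk i h1 h2
    obtain ⟨hstep, -, -⟩ := hD.isStep hW hd hsq hchar hk
    have hz := hstep.z_ne_zero
    rcases lt_or_ge i k with h | h
    · obtain ⟨v, c, hvc, hc⟩ := ih (by omega) i h1 h
      refine ⟨_, _, hstep.unit _ _ _ hvc, ?_⟩
      rw [Polynomial.coeff_C_zero]
      exact mul_ne_zero (pow_ne_zero _ (pow_ne_zero _ hz)) hc
    -- The factor `y` of the pull-back of `φ_k` becomes `x ^ m (y + z^s + …)`, which is a monomial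
    -- times a unit because `z ≠ 0`.
    · obtain rfl : i = k := by push_cast at h2; omega
      obtain ⟨-, -, -, -, U, α, b, hU, hform, hb⟩ := hD.phi_spec hW hd hsq hchar k (by omega)
      have hpull := hstep.pullback_var_mul hform
      rw [← hU, ← phi_natCast] at hpull
      refine ⟨_, _, hpull, ?_⟩
      rw [Polynomial.coeff_C_mul, Polynomial.coeff_add, Polynomial.coeff_X_zero,
        Polynomial.coeff_C_zero, zero_add]
      exact mul_ne_zero (mul_ne_zero (pow_ne_zero _ (pow_ne_zero _ hz)) hb) (pow_ne_zero _ hz)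

theorem IsRun.hasInitialForm_phi_zero (hD : D.IsRun F) (hW : IsWeierstrass F)
    (hd : 0 < F.natDegree) (hsq : Squarefree F)
    (hchar : ∀ n : ℕ, 0 < n → n ≤ F.natDegree → (n : K) ≠ 0) :
    HasInitialForm (D.piPull K 0 (D.phi K 0)) 0 Polynomial.X := by
  obtain ⟨-, hmon, hdeg, hroot, -⟩ := hD.phi_spec hW hd hsq hchar 0 (Nat.zero_le _)
  have := D.phi_natCast (K := K) 0
  rw [Nat.cast_zero] at this
  rw [this, D.piPull_zero_eq_X hmon hdeg hroot]
  exact ⟨Polynomial.X, by simp, by simp⟩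

/-- The existence statement of `phi_spec` forgets the constants; here those of ranks `k` and `k + 1`
are exposed together with their relation. -/
theorem IsRun.phi_succ_spec (hD : D.IsRun F) (hW : IsWeierstrass F)
    (hd : 0 < F.natDegree) (hsq : Squarefree F)
    (hchar : ∀ n : ℕ, 0 < n → n ≤ F.natDegree → (n : K) ≠ 0) {k : ℕ} (hk : k < D.g) :
    ∃ (U U' : E⟦X⟧[X]) (α : ℕ) (b b' : E[X]),
      D.piPull K k (D.minimalPolynomial K k) = Polynomial.X * U ∧
      HasInitialForm U α b ∧ b.coeff 0 ≠ 0 ∧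
      D.piPull K (k + 1) (D.minimalPolynomial K (k + 1)) = Polynomial.X * U' ∧
      HasInitialForm U' (D.q (k + 1) * D.ell (k + 1) * (D.q (k + 1) * α + D.m (k + 1))) b' ∧
      b'.coeff 0 ≠ 0 ∧
      b'.coeff 0 = D.q (k + 1) * D.z (k + 1) ^ (1 - (D.s (k + 1) : ℤ) - (D.ell (k + 1) : ℤ)) *
        (D.P (k + 1)).derivative.eval (D.z (k + 1)) *
        (b.coeff 0 * D.z (k + 1) ^ (D.t (k + 1) * α + D.s (k + 1))) ^
          (D.q (k + 1) * D.ell (k + 1)) := by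
  obtain ⟨hunit, hmon, hdeg, -, U, α, b, hU, hform, hb⟩ := hD.phi_spec hW hd hsq hchar k hk.le
  obtain ⟨-, hmon', hdeg', hroot', -⟩ := hD.phi_spec hW hd hsq hchar (k + 1) hk
  obtain ⟨hstep, hq0, hl0⟩ := hD.isStep hW hd hsq hchar hk
  obtain ⟨U', b', hU', hform', hb'⟩ := hstep.pullback_monic
    (fun A i j => mem_seriesOver.mp (coeff_mem_seriesOver (hD.piPull_mem k hk.le A) i) j)
    hunit hmon hdeg hU hform hb hmon' hdeg' hroot'
  refine ⟨U, U', α, b, b', hU, hform, hb, hU', hform', ?_, hb'⟩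
  rw [hb']
  have hz := hstep.z_ne_zero
  exact mul_ne_zero (mul_ne_zero (mul_ne_zero hq0 (zpow_ne_zero _ hz))
    (eval_derivative_ne_zero hstep.monic hstep.irreducible hstep.root hl0))
    (pow_ne_zero _ (mul_ne_zero hb (pow_ne_zero _ hz)))

end RationalPuiseux.Data

end

theorem mainTheorem9 {K : Type*} {E : Type*} [Field K] [PerfectField K] [Field E] [Algebra K E]
    (F : Polynomial (PowerSeries K)) (hW : RationalPuiseux.IsWeierstrass F)
    (hd : 0 < F.natDegree) (hsq : Squarefree F)
    (hchar : ringChar K = 0 ∨ F.natDegree < ringChar K)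
    (D : RationalPuiseux.Data E) (hD : D.IsRun F) :
    -- the two formulas
    (∀ k : ℕ, 1 ≤ k → k ≤ D.g →
      D.vv K k k = D.q k * D.ell k * D.vv K k (k - 1) ∧
      D.ll K k k = D.q k * D.z k ^ (1 - (D.s k : ℤ) - (D.ell k : ℤ)) *
        (D.P k).derivative.eval (D.z k) * D.ll K k (k - 1) ^ (D.q k * D.ell k)) ∧
    -- the initial values of `V` and `Λ`
    (D.vv K 0 (-1) = 1 ∧ D.vv K 0 0 = 0 ∧ D.ll K 0 (-1) = 1 ∧ D.ll K 0 0 = 1) ∧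
    -- the remaining update formulas
    (∀ k : ℕ, 1 ≤ k → k ≤ D.g →
      (∀ i : ℤ, -1 ≤ i → i < k - 1 →
        D.vv K k i = D.q k * D.vv K (k - 1) i ∧
        D.ll K k i = D.ll K (k - 1) i * D.z k ^ (D.t k * (D.vv K (k - 1) i).toNat)) ∧
      D.vv K k (k - 1) = D.q k * D.vv K (k - 1) (k - 1) + D.m k ∧
      D.ll K k (k - 1) = D.ll K (k - 1) (k - 1) *
        D.z k ^ (D.t k * (D.vv K (k - 1) (k - 1)).toNat + D.s k)) := by
  have hchar' : ∀ n : ℕ, 0 < n → n ≤ F.natDegree → (n : K) ≠ 0 := by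
    intro n hn hn' h
    have hdvd := (ringChar.spec K n).mp h
    rcases hchar with h0 | h0
    · rw [h0, zero_dvd_iff] at hdvd
      omega
    · have := Nat.le_of_dvd hn hdvd
      omega
  have hne : ∀ {b : Polynomial E}, b.coeff 0 ≠ 0 → b ≠ 0 := by
    rintro b hb rfl
    simp at hb
  -- At its own rank `φ_k` pulls back to `y U`; the trailing coefficient ignores the factor `y`, so
  -- `U` determines both entries.
  have hinit : ∀ k ≤ D.g, ∀ {U : Polynomial (PowerSeries E)} {α : ℕ} {b : Polynomial E},
      D.piPull K k (D.minimalPolynomial K k) = Polynomial.X * U →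
      RationalPuiseux.HasInitialForm U α b → b.coeff 0 ≠ 0 →
      D.vv K k k = α ∧ D.ll K k k = b.coeff 0 := by
    intro k _ U α b hU hform hb
    have h1 := RationalPuiseux.Data.IsRun.vv_ll_of_hasInitialForm (K := K) (D := D) (i := (k : ℤ))
      (by rw [RationalPuiseux.Data.phi_natCast, hU]; exact hform.X_mul)
      (mul_ne_zero Polynomial.X_ne_zero (hne hb))
    rwa [RationalPuiseux.trailingCoeff_X_mul hb] at h1
  -- One rank later the factor `y` contributes `m` to the valuation and `z^s` to the trailing
  -- coefficient.
  have hprev : ∀ k < D.g, ∀ {U : Polynomial (PowerSeries E)} {α : ℕ} {b : Polynomial E},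
      D.piPull K k (D.minimalPolynomial K k) = Polynomial.X * U →
      RationalPuiseux.HasInitialForm U α b → b.coeff 0 ≠ 0 →
      D.vv K (k + 1) k = D.q (k + 1) * α + D.m (k + 1) ∧
      D.ll K (k + 1) k = b.coeff 0 * D.z (k + 1) ^ (D.t (k + 1) * α + D.s (k + 1)) := by
    intro k hk U α b hU hform hb
    obtain ⟨hstep, -, -⟩ := hD.isStep hW hd hsq hchar' hk
    have hz := hstep.z_ne_zero
    have h1 := hstep.pullback_var_mul hform
    rw [← hU] at h1
    set c := Polynomial.C ((D.z (k + 1) ^ D.t (k + 1)) ^ α * b.coeff 0) *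
      (Polynomial.X + Polynomial.C (D.z (k + 1) ^ D.s (k + 1))) with hc
    have hc0 : c.coeff 0 = b.coeff 0 * D.z (k + 1) ^ (D.t (k + 1) * α + D.s (k + 1)) := by
      rw [hc, Polynomial.coeff_C_mul, Polynomial.coeff_add, Polynomial.coeff_X_zero,
        Polynomial.coeff_C_zero, zero_add, pow_add, pow_mul]
      ring
    have hc1 : c.coeff 0 ≠ 0 := by
      rw [hc0]; exact mul_ne_zero hb (pow_ne_zero _ hz)
    have h2 := RationalPuiseux.Data.IsRun.vv_ll_of_hasInitialForm (K := K) (D := D) (k := k + 1)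
      (i := (k : ℤ)) (by rw [RationalPuiseux.Data.phi_natCast]; exact h1) (hne hc1)
    rw [RationalPuiseux.trailingCoeff_of_coeff_zero_ne_zero hc1, hc0] at h2
    exact ⟨by rw [h2.1]; push_cast; rfl, h2.2⟩
  have hcast : ∀ k : ℕ, ((k + 1 : ℕ) : ℤ) - 1 = (k : ℤ) := fun k => by push_cast; ring
  refine ⟨?_, ?_, ?_⟩
  · intro k hk hkg
    obtain ⟨k, rfl⟩ := Nat.exists_eq_add_of_le' hk
    rw [hcast]
    obtain ⟨U, U', α, b, b', hU, hform, hb, hU', hform', hb'0, hb'⟩ :=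
      hD.phi_succ_spec hW hd hsq hchar' hkg
    obtain ⟨hv, hl⟩ := hprev k hkg hU hform hb
    obtain ⟨hv', hl'⟩ := hinit (k + 1) hkg hU' hform' hb'0
    refine ⟨?_, ?_⟩
    · rw [hv', hv]
      push_cast
      rfl
    · rw [hl', hl, hb']
  · have hx := RationalPuiseux.Data.IsRun.vv_ll_of_hasInitialForm
      (D.hasInitialForm_phi_neg_one (K := K)) one_ne_zero
    have h0 := RationalPuiseux.Data.IsRun.vv_ll_of_hasInitialForm (D := D) (i := 0)
      (hD.hasInitialForm_phi_zero hW hd hsq hchar') Polynomial.X_ne_zero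
    rw [RationalPuiseux.trailingCoeff_of_coeff_zero_ne_zero (by simp)] at hx
    refine ⟨by rw [hx.1]; rfl, by rw [h0.1]; rfl, by rw [hx.2]; simp, by
      rw [h0.2, Polynomial.trailingCoeff, Polynomial.natTrailingDegree_X, Polynomial.coeff_X_one]⟩
  · intro k hk hkg
    obtain ⟨k, rfl⟩ := Nat.exists_eq_add_of_le' hk
    rw [hcast, Nat.add_sub_cancel]
    obtain ⟨hstep, -, -⟩ := hD.isStep hW hd hsq hchar' hkg
    have hz := hstep.z_ne_zero
    refine ⟨fun i hi hik => ?_, ?_⟩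
    · obtain ⟨v, c, hvc, hc⟩ := hD.exists_hasInitialForm_phi hW hd hsq hchar' k (by omega) i hi hik
      have hc' : (Polynomial.C ((D.z (k + 1) ^ D.t (k + 1)) ^ v * c.coeff 0)).coeff 0 ≠ 0 := by
        rw [Polynomial.coeff_C_zero]
        exact mul_ne_zero (pow_ne_zero _ (pow_ne_zero _ hz)) hc
      have h1 := RationalPuiseux.Data.IsRun.vv_ll_of_hasInitialForm hvc (hne hc)
      have h2 := RationalPuiseux.Data.IsRun.vv_ll_of_hasInitialForm (K := K) (D := D) (k := k + 1)
        (hstep.unit _ _ _ hvc) (hne hc')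
      rw [RationalPuiseux.trailingCoeff_of_coeff_zero_ne_zero hc] at h1
      rw [RationalPuiseux.trailingCoeff_of_coeff_zero_ne_zero hc', Polynomial.coeff_C_zero] at h2
      rw [h2.1, h2.2, h1.1, h1.2]
      refine ⟨by push_cast; rfl, ?_⟩
      rw [ENat.toNat_natCast, pow_mul, mul_comm]
    · obtain ⟨U, U', α, b, b', hU, hform, hb, -⟩ := hD.phi_succ_spec hW hd hsq hchar' hkg
      obtain ⟨hv, hl⟩ := hprev k hkg hU hform hb
      obtain ⟨hv', hl'⟩ := hinit k (by omega) hU hform hb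
      rw [hv, hl, hv', hl', ENat.toNat_natCast]
      exact ⟨rfl, rfl⟩
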